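/- Let $\chi$ be a primitive Dirichlet character of odd conductor $N\ge 1$ and of order $m$. Put $v=\chi(-1)\in\{1,-1\}$, $\epsilon=0$ if $v=1$ and $\epsilon=1$ if $v=-1$, $M=24mN^2$, and $n=m$ if $m$ is even, $n=2m$ if $m$ is odd. For a Dirichlet character $\psi$ modulo $N$ with $\psi(-1)=v$ and $\tau$ in the upper half-plane $\mathcal H$ let $$\theta_\psi(\tau)=\sum_{k\in\mathbb Z}k^{\epsilon}\,\psi(k)\,e^{\pi i k^2\tau/N},\qquad A_\psi(\tau)=\frac{\theta_\psi(\tau/N)}{\eta(\tau/N)^{1+2\epsilon}},\qquad B_\psi(\tau)=A_\psi(\tau)\,A_{\bar\psi}(\tau),$$ where $\eta(\tau)=q^{1/24}\prod_{k\ge1}(1-q^k)$, $q=e^{2\pi i\tau}$, is the Dedekind eta function. Let $F_M$ be the field of modular functions of level $M$: the functions that are meromorphic on $\mathcal H$ and at the cusps, invariant under $\Gamma(M)$, and whose Fourier coefficients in the expansion at $i\infty$ in powers of $q^{1/M}$ lie in $\mathbb Q(\zeta_M)$, $\zeta_M=e^{2\pi i/M}$. The group $\mathrm{GL}_2(\mathbb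 Z/M\mathbb Z)$ acts on $F_M$ on the right: write $\mu=\begin{pmatrix}1&0\\0&\det\mu\end{pmatrix}\gamma$ with $\gamma\in\mathrm{SL}_2(\mathbb Z/M\mathbb Z)$; then $f|\mu=f^{\sigma}\circ\tilde\gamma$, where $\tilde\gamma\in\mathrm{SL}_2(\mathbb Z)$ is any lift of $\gamma$ and $f^\sigma\in F_M$ is obtained from $f$ by applying to its Fourier coefficients the automorphism $\sigma$ of $\mathbb Q(\zeta_M)$ with $\sigma(\zeta_M)=\zeta_M^{\det\mu}$. Then $A_\chi,B_\chi\in F_M$, and for every $$\mu=\begin{pmatrix}t&-N^2s\\ s&t\end{pmatrix}\in\mathrm{GL}_2(\mathbb Z/M\mathbb Z),\qquad t,s\in\mathbb Z/M\mathbb Z,$$ one has $$B_\chi|\mu=(-1)^{\frac{N-v}{2}(t-1)}\,B_{\chi^{\det\mu}}\qquad\text{and}\qquad (A_\chi|\mu)^n=(-1)^{\frac{(N-v)n}{4}(t-1)}\,A_{\chi^{\det\mu}}^{\,n}.$$ (The signs are well defined since $M$ is even, and $\chi^{\det\mu}$ is well defined since $m\mid M$.) -/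

import Mathlib

open Complex
open UpperHalfPlane hiding I

noncomputable section

/-! ### Theta series and the functions `A_χ`, `B_χ` -/

open Classical in
/-- `ε = 0` for an even character, `ε = 1` for an odd one. -/
def charEps {N : ℕ} (χ : DirichletCharacter ℂ N) : ℕ := if χ.Even then 0 else 1

open Classical in
/-- `v = χ(-1)`, as an integer. -/
def charSign {N : ℕ} (χ : DirichletCharacter ℂ N) : ℤ := if χ.Even then 1 else -1

/-- `θ_χ(z) = ∑_{n ∈ ℤ} n^ε χ(n) e^{π i n² z / N}` (with `0 ^ 0 = 1`). -/
def thetaChar {N : ℕ} (χ : DirichletCharacter ℂ N) (z : ℂ) : ℂ :=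
  ∑' n : ℤ, (n : ℂ) ^ charEps χ * χ (n : ZMod N) * exp (Real.pi * I * (n : ℂ) ^ 2 * z / N)

/-- `A_χ(τ) = θ_χ(τ/N) / η(τ/N)^{1+2ε}`. -/
def funA {N : ℕ} (χ : DirichletCharacter ℂ N) (τ : ℍ) : ℂ :=
  thetaChar χ ((τ : ℂ) / N) / ModularForm.eta ((τ : ℂ) / N) ^ (1 + 2 * charEps χ)

/-- `B_χ(τ) = A_χ(τ) A_{χ̄}(τ)`; the inverse of a Dirichlet character is its complex conjugate. -/
def funB {N : ℕ} (χ : DirichletCharacter ℂ N) (τ : ℍ) : ℂ := funA χ τ * funA χ⁻¹ τ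

/-! ### The field `ℚ(ζ_M)` and its automorphisms -/

/-- `ζ_M = e^{2πi/M}`. -/
def zetaM (M : ℕ) : ℂ := exp (2 * Real.pi * I / M)

/-- `ℚ(ζ_M)` as a subfield of `ℂ`. -/
abbrev cycField (M : ℕ) : IntermediateField ℚ ℂ := IntermediateField.adjoin ℚ {zetaM M}

theorem zetaM_mem (M : ℕ) : zetaM M ∈ cycField M :=
  IntermediateField.mem_adjoin_simple_self ℚ (zetaM M)

theorem zetaM_isPrimitiveRoot (M : ℕ) [NeZero M] : IsPrimitiveRoot (zetaM M) M :=
  Complex.isPrimitiveRoot_exp M (NeZero.ne M)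

instance cycField_isCyclotomicExtension (M : ℕ) [NeZero M] :
    IsCyclotomicExtension {M} ℚ (cycField M) := by
  have hζ := zetaM_isPrimitiveRoot M
  have hint : IsIntegral ℚ (zetaM M) := (hζ.isIntegral (NeZero.pos M)).tower_top
  change IsCyclotomicExtension {M} ℚ (IntermediateField.adjoin ℚ {zetaM M}).toSubalgebra
  rw [IntermediateField.adjoin_simple_toSubalgebra_of_isAlgebraic hint.isAlgebraic]
  exact hζ.adjoin_isCyclotomicExtension ℚ

/-- The automorphism `σ_d` of `ℚ(ζ_M)` with `σ_d(ζ_M) = ζ_M ^ d`. -/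
def sigmaAut (M : ℕ) [NeZero M] (d : (ZMod M)ˣ) : cycField M ≃ₐ[ℚ] cycField M :=
  (IsCyclotomicExtension.autEquivPow (cycField M)
    (Polynomial.cyclotomic.irreducible_rat (NeZero.pos M))).symm d

theorem sigmaAut_zetaM (M : ℕ) [NeZero M] (d : (ZMod M)ˣ) :
    (sigmaAut M d ⟨zetaM M, zetaM_mem M⟩ : ℂ) = zetaM M ^ (d : ZMod M).val := by
  have h1 : (⟨zetaM M, zetaM_mem M⟩ : cycField M) ^ M = 1 := by
    apply Subtype.ext
    simpa using (zetaM_isPrimitiveRoot M).pow_eq_one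
  have : NumberField (cycField M) := IsCyclotomicExtension.numberField {M} ℚ (cycField M)
  have h := IsCyclotomicExtension.Rat.galEquivZMod_apply_of_pow_eq M (cycField M)
    (sigmaAut M d) h1
  have h2 : IsCyclotomicExtension.Rat.galEquivZMod M (cycField M) (sigmaAut M d) = d :=
    MulEquiv.apply_symm_apply _ _
  rw [h, h2]
  rfl

/-! ### Modular functions of level `M` -/

/-- `f` has the Laurent expansion `∑_k c_k q^{k/M}`, `q = e^{2πiτ}`, near `i∞`
(a Laurent series has only finitely many terms of negative exponent). -/
def HasFourierExpansion (M : ℕ) (f : ℍ → ℂ) (c : LaurentSeries ℂ) : Prop :=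
  ∃ Y : ℝ, ∀ τ : ℍ, Y < τ.im →
    HasSum (fun k : ℤ => c.coeff k * exp (2 * Real.pi * I * k * (τ : ℂ) / M)) (f τ)

/-- A Laurent series over `ℚ(ζ_M)`, viewed as one over `ℂ`. -/
def toComplexSeries {M : ℕ} (c : LaurentSeries (cycField M)) : LaurentSeries ℂ :=
  HahnSeries.map c (algebraMap (cycField M) ℂ)

/-- The elements of the field `F_M`: the `Γ(M)`-invariant functions, meromorphic on `ℍ` and at
all cusps, whose Fourier coefficients (in `q^{1/M}`, at `i∞`) lie in `ℚ(ζ_M)`. A meromorphic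
function is represented by the function `ℍ → ℂ` in normal form, that is, with value `0` at its
poles and with its limit as value everywhere else. -/
structure IsModularFunction (M : ℕ) (f : ℍ → ℂ) : Prop where
  meromorphic : MeromorphicNFOn (fun z : ℂ => f (ofComplex z)) {z : ℂ | 0 < z.im}
  invariant : ∀ γ ∈ CongruenceSubgroup.Gamma M, ∀ τ : ℍ, f (γ • τ) = f τ
  cusps : ∀ γ : Matrix.SpecialLinearGroup (Fin 2) ℤ,
    ∃ c : LaurentSeries ℂ, HasFourierExpansion M (fun τ => f (γ • τ)) c
  rational : ∃ c : LaurentSeries (cycField M), HasFourierExpansion M f (toComplexSeries c)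

/-- `g = f^{σ_d}`: both are in `F_M`, and `g = ∑ σ_d(c_k) q^{k/M}` for `f = ∑ c_k q^{k/M}`. -/
def IsGaloisConjugate (M : ℕ) [NeZero M] (d : (ZMod M)ˣ) (f g : ℍ → ℂ) : Prop :=
  IsModularFunction M f ∧ IsModularFunction M g ∧
    ∃ c : LaurentSeries (cycField M), HasFourierExpansion M f (toComplexSeries c) ∧
      HasFourierExpansion M g (toComplexSeries (HahnSeries.map c (sigmaAut M d)))

/-- `g = f | μ` for `f ∈ F_M` and `μ ∈ GL₂(ℤ/M)`: writing `μ = diag(1, det μ) γ` with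
`γ ∈ SL₂(ℤ)` reduced modulo `M`, one has `f | μ = f^{σ_{det μ}} ∘ γ`. By `Γ(M)`-invariance the
choice of `γ` does not matter, and `f` and `μ` determine `g`. -/
def IsModularAction (M : ℕ) [NeZero M] (μ : Matrix.GeneralLinearGroup (Fin 2) (ZMod M))
    (f g : ℍ → ℂ) : Prop :=
  ∃ h : ℍ → ℂ, IsGaloisConjugate M (Matrix.GeneralLinearGroup.det μ) f h ∧
    ∃ γ : Matrix.SpecialLinearGroup (Fin 2) ℤ,
      (μ : Matrix (Fin 2) (Fin 2) (ZMod M)) =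
        !![1, 0; 0, (Matrix.GeneralLinearGroup.det μ : ZMod M)] *
          (γ : Matrix (Fin 2) (Fin 2) ℤ).map (Int.cast : ℤ → ZMod M) ∧
      ∀ τ : ℍ, g τ = h (γ • τ)

/-- `χ^{det μ}` for `μ ∈ GL₂(ℤ/M)`; when the order of `χ` divides `M`, it does not depend on
the representative of `det μ`. -/
def charPowDet {N M : ℕ} (χ : DirichletCharacter ℂ N)
    (μ : Matrix.GeneralLinearGroup (Fin 2) (ZMod M)) : DirichletCharacter ℂ N :=
  χ ^ (Matrix.GeneralLinearGroup.det μ : ZMod M).val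

end

/-!
The numerator `θ_ψ(τ/N)` is a combination, with coefficients `ψ(r)`, of the theta functions
`T_r(τ) = ∑_{n ∈ r/N + ℤ} n^ε e^{πin²τ}` of the residue classes `r` modulo `N`, and these are theta
functions with rational characteristics. In the normalization of Klein forms, theta functions with
characteristics are permuted by the whole of `SL₂(ℤ)`, which acts on the characteristic `(x, y)` by
right multiplication (`siegel_smul`), and an integral shift of the characteristic produces an
explicit root of unity (`klein_add_intCast`). For `γ = (a, b; c, e)` with `N² ∣ b`, and under the
parity conditions that the `SL₂`-parts of Cartan matrices satisfy, it follows that `T_r ∘ γ`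
is a multiple of `T_{ar}`, with a factor independent of `r` (`thetaRes_smul`). Hence `γ` multiplies
the numerator of `A_ψ` by `ψ(a)⁻¹` and a root of unity (`thetaQuot_smul`).

The denominator is a power of `η(τ/N)`. The square of `η` transforms under `SL₂(ℤ)` with a character
of order `12` for which there is a closed formula (`ell`, `eta_sq_smul`), and `γ` acts on `τ/N` as
the conjugate matrix `(a, b/N; Nc, e)`. This determines the multiplier of `A_ψ A_φ` for any two
characters of the same parity (`funA_mul_funA_smul`); the factors `ψ(a)⁻¹` cancel in
`B_ψ = A_ψ A_{ψ⁻¹}`, and disappear from `A_ψ^n` because `m ∣ n`. For Cartan matrices the remaining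
root of unity is a sign, which is a finite verification modulo `3` and modulo `4`
(`cartan_exponent`).

That `A_ψ` itself, and not only its square, is invariant under `Γ(M)` and meromorphic at all cusps
needs more than the transformation of `η²`. By the Jacobi triple product, the quotient `η(τ/N)/η(τ)`
is up to a constant a product of `(N - 1)/2` Siegel functions (`prod_siegel_eq`), so the action
of `SL₂(ℤ)` on Siegel functions settles both questions (`funA_invariant`, `isMeroAtInfty_funA_smul`).

Finally the expansion of `θ_ψ(τ/N)` in powers of `q^{1/M}` has coefficients `k^ε ψ(k)`, and that of
`η(τ/N)` is rational by the pentagonal number theorem (`hasSum_eta`). The automorphism `σ_d` maps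
`ψ(k)` to `ψ(k)^d`, so that it maps `A_ψ` to `A_{ψ^d}` (`isGaloisConjugate_funA`), and it remains
to apply the multiplier to `ψ = χ^d`.
-/

noncomputable section

/-! ### The Jacobi triple product -/

/-- The finite `q`-Pochhammer symbol `(q; q)_n = ∏_{k=1}^n (1 - q^k)`. -/
def qPoch (q : ℂ) (n : ℕ) : ℂ := ∏ k ∈ Finset.range n, (1 - q ^ (k + 1))

/-- `1 / (q; q)_m`, extended by `0` to negative `m`. -/
def qPochInv (q : ℂ) (m : ℤ) : ℂ := if m < 0 then 0 else (qPoch q m.toNat)⁻¹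

lemma one_sub_pow_succ_ne_zero {q : ℂ} (hq : ‖q‖ < 1) (n : ℕ) : 1 - q ^ (n + 1) ≠ 0 := by
  intro h
  have h1 : ‖q ^ (n + 1)‖ < 1 := by
    rw [norm_pow]; exact pow_lt_one₀ (norm_nonneg _) hq (by omega)
  rw [← sub_eq_zero.mp h] at h1
  simp at h1

lemma qPoch_ne_zero {q : ℂ} (hq : ‖q‖ < 1) (n : ℕ) : qPoch q n ≠ 0 :=
  Finset.prod_ne_zero_iff.mpr fun k _ => one_sub_pow_succ_ne_zero hq k

/-- The recursion `1 / (q; q)_{m-1} = (1 - q^m) / (q; q)_m` holds for every integer `m`. -/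
lemma qPochInv_sub_one {q : ℂ} (hq : ‖q‖ < 1) (m : ℤ) :
    qPochInv q (m - 1) = (1 - q ^ m) * qPochInv q m := by
  rcases lt_trichotomy m 0 with h | h | h
  · simp [qPochInv, h, show m - 1 < 0 by omega]
  · simp [qPochInv, h]
  · obtain ⟨k, rfl⟩ : ∃ k : ℕ, m = k + 1 := ⟨(m - 1).toNat, by omega⟩
    have h2 : ((k : ℤ) + 1).toNat = k + 1 := by omega
    have h3 : (q : ℂ) ^ ((k : ℤ) + 1) = q ^ (k + 1) := by exact_mod_cast zpow_natCast q (k + 1)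
    have h4 : qPoch q (k + 1) = qPoch q k * (1 - q ^ (k + 1)) := Finset.prod_range_succ _ _
    have := one_sub_pow_succ_ne_zero hq k
    have := qPoch_ne_zero hq k
    simp only [qPochInv, show ¬ ((k : ℤ) < 0) by omega, show ¬ ((k : ℤ) + 1 < 0) by omega,
      if_false, h2, h3, add_sub_cancel_right, Int.toNat_natCast, h4]
    field_simp

lemma triangular_succ (j : ℤ) : (j + 1) * (j + 1 + 1) / 2 = j * (j + 1) / 2 + (j + 1) := by
  rw [show (j + 1) * (j + 1 + 1) = j * (j + 1) + (j + 1) * 2 by ring,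
    Int.add_mul_ediv_right _ _ (by norm_num)]

/-- The coefficients of the finite triple product. -/
def tripleCoeff (q : ℂ) (n : ℕ) (j : ℤ) : ℂ :=
  (-1) ^ j * q ^ (j * (j + 1) / 2) * (qPoch q (2 * n) * qPochInv q (n - j) * qPochInv q (n + j))

/-- The effect on the coefficients of multiplying by the two factors
`(1 - q^{n+1} ζ)(1 - q^n ζ⁻¹)`. -/
lemma tripleCoeff_succ {q : ℂ} (hq : ‖q‖ < 1) (hq0 : q ≠ 0) (n : ℕ) (j : ℤ) :
    tripleCoeff q (n + 1) j = (1 + q ^ (2 * n + 1)) * tripleCoeff q n j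
      - q ^ (n + 1) * tripleCoeff q n (j - 1) - q ^ n * tripleCoeff q n (j + 1) := by
  have hA : qPochInv q (n - j) = (1 - q ^ ((n : ℤ) + 1 - j)) * qPochInv q (n + 1 - j) := by
    rw [← qPochInv_sub_one hq]; congr 1; ring
  have hA' : qPochInv q (n - (j + 1)) = (1 - q ^ ((n : ℤ) - j)) * qPochInv q (n - j) := by
    rw [← qPochInv_sub_one hq]; congr 1; ring
  have hB : qPochInv q (n + j) = (1 - q ^ ((n : ℤ) + 1 + j)) * qPochInv q (n + 1 + j) := by
    rw [← qPochInv_sub_one hq]; congr 1; ring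
  have hB' : qPochInv q (n + (j - 1)) = (1 - q ^ ((n : ℤ) + j)) * qPochInv q (n + j) := by
    rw [← qPochInv_sub_one hq]; congr 1; ring
  have h1 : (n : ℤ) - (j - 1) = n + 1 - j := by ring
  have h2 : (n : ℤ) + (j + 1) = n + 1 + j := by ring
  have hu : qPoch q (2 * (n + 1)) = qPoch q (2 * n) * (1 - q ^ (2 * n + 1)) *
      (1 - q ^ (2 * n + 2)) := by
    rw [show 2 * (n + 1) = 2 * n + 1 + 1 by ring, qPoch, Finset.prod_range_succ,
      Finset.prod_range_succ]; rfl
  have ht1 := triangular_succ j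
  have ht2 := triangular_succ (j - 1)
  rw [sub_add_cancel] at ht2
  have ht3 : (j - 1) * j / 2 = j * (j + 1) / 2 - j := by omega
  simp only [tripleCoeff, Nat.cast_add, Nat.cast_one, h1, h2, hA', hB', hA, hB, hu,
    sub_add_cancel, ht1, ht3]
  have hz1 : ((-1 : ℂ)) ^ (j + 1) = - (-1) ^ j := by
    rw [zpow_add₀ (by norm_num)]; simp
  have hz2 : ((-1 : ℂ)) ^ (j - 1) = - (-1) ^ j := by
    rw [zpow_sub₀ (by norm_num)]; simp [div_neg]
  rw [hz1, hz2]
  have e1 : q ^ (2 * n + 1) = q ^ (n : ℤ) * q ^ (n : ℤ) * q := by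
    rw [zpow_natCast]; ring
  have e2 : q ^ (2 * n + 2) = q ^ (n : ℤ) * q ^ (n : ℤ) * q * q := by
    rw [zpow_natCast]; ring
  have e3 : q ^ (n + 1) = q ^ (n : ℤ) * q := by rw [zpow_natCast]; ring
  have e4 : q ^ n = q ^ (n : ℤ) := by rw [zpow_natCast]
  rw [e1, e2, e3, e4]
  simp only [zpow_sub₀ hq0, zpow_add₀ hq0, zpow_one]
  have hj : q ^ j ≠ 0 := zpow_ne_zero _ hq0
  generalize q ^ (j * (j + 1) / 2) = t
  generalize q ^ (n : ℤ) = N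
  generalize q ^ j = J at *
  field_simp
  ring

/-- The finite Jacobi triple product. -/
lemma hasSum_tripleCoeff {q : ℂ} (hq : ‖q‖ < 1) (hq0 : q ≠ 0) {ζ : ℂ} (hζ : ζ ≠ 0) (n : ℕ) :
    HasSum (fun j : ℤ => tripleCoeff q n j * ζ ^ j)
      (∏ k ∈ Finset.range n, (1 - q ^ (k + 1) * ζ) * (1 - q ^ k * ζ⁻¹)) := by
  induction n with
  | zero =>
    have : ∏ k ∈ Finset.range 0, (1 - q ^ (k + 1) * ζ) * (1 - q ^ k * ζ⁻¹) =
        tripleCoeff q 0 0 * ζ ^ (0 : ℤ) := by simp [tripleCoeff, qPoch, qPochInv]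
    rw [this]
    refine hasSum_single 0 fun j hj => ?_
    rcases lt_or_gt_of_ne hj with h | h
    · simp [tripleCoeff, qPochInv, h]
    · simp [tripleCoeff, qPochInv, h]
  | succ n ih =>
    rw [Finset.prod_range_succ]
    have s1 := (ih.mul_left (1 + q ^ (2 * n + 1)))
    have s2 := (((Equiv.subRight (1 : ℤ)).hasSum_iff).mpr ih).mul_left (q ^ (n + 1) * ζ)
    have s3 := (((Equiv.addRight (1 : ℤ)).hasSum_iff).mpr ih).mul_left (q ^ n * ζ⁻¹)
    have e : (fun j : ℤ => tripleCoeff q (n + 1) j * ζ ^ j) = fun j : ℤ =>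
        (1 + q ^ (2 * n + 1)) * (tripleCoeff q n j * ζ ^ j)
        - q ^ (n + 1) * ζ * ((fun j : ℤ => tripleCoeff q n j * ζ ^ j) ∘ Equiv.subRight (1 : ℤ)) j
        - q ^ n * ζ⁻¹ * ((fun j : ℤ => tripleCoeff q n j * ζ ^ j) ∘ Equiv.addRight (1 : ℤ)) j := by
      funext j
      simp only [Function.comp, Equiv.subRight_apply, Equiv.coe_addRight, tripleCoeff_succ hq hq0,
        zpow_add₀ hζ, zpow_sub₀ hζ, zpow_one]
      field_simp
    rw [e]
    convert! (s1.sub s2).sub s3 using 1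
    generalize ∏ k ∈ Finset.range n, (1 - q ^ (k + 1) * ζ) * (1 - q ^ k * ζ⁻¹) = p
    field_simp
    ring

lemma tendsto_qPoch {q : ℂ} (hq : ‖q‖ < 1) :
    Filter.Tendsto (qPoch q) Filter.atTop (nhds (∏' n : ℕ, (1 - q ^ (n + 1)))) :=
  (ModularForm.multipliable_one_sub_pow hq).hasProd.tendsto_prod_nat

lemma tprod_one_sub_pow_ne_zero {q : ℂ} (hq : ‖q‖ < 1) : ∏' n : ℕ, (1 - q ^ (n + 1)) ≠ 0 := by
  simp_rw [sub_eq_add_neg]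
  refine tprod_one_add_ne_zero_of_summable (f := fun n : ℕ => -q ^ (n + 1))
    (fun n => by simpa [sub_eq_add_neg] using one_sub_pow_succ_ne_zero hq n) ?_
  simpa [summable_nat_add_iff] using
    (summable_nat_add_iff 1).mpr (summable_geometric_of_lt_one (norm_nonneg _) hq)

lemma exists_norm_qPoch_le {q : ℂ} (hq : ‖q‖ < 1) : ∃ C : ℝ, ∀ n, ‖qPoch q n‖ ≤ C := by
  obtain ⟨C, hC⟩ := (Metric.isBounded_range_of_tendsto _ (tendsto_qPoch hq)).exists_norm_le
  exact ⟨C, fun n => hC _ ⟨n, rfl⟩⟩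

/-- The bound that dominates the coefficients of the finite products, uniformly in their length. -/
lemma exists_norm_qPochInv_le {q : ℂ} (hq : ‖q‖ < 1) :
    ∃ C : ℝ, 0 ≤ C ∧ ∀ m, ‖qPochInv q m‖ ≤ C := by
  obtain ⟨C, hC⟩ := (Metric.isBounded_range_of_tendsto _
    ((tendsto_qPoch hq).inv₀ (tprod_one_sub_pow_ne_zero hq))).exists_norm_le
  have h0 : 0 ≤ C := (norm_nonneg _).trans (hC _ ⟨0, rfl⟩)
  refine ⟨C, h0, fun m => ?_⟩
  unfold qPochInv
  split_ifs
  · simpa using h0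
  · exact hC _ ⟨_, rfl⟩

lemma tendsto_qPochInv {q : ℂ} (hq : ‖q‖ < 1) {f : ℕ → ℤ}
    (hf : Filter.Tendsto f Filter.atTop Filter.atTop) :
    Filter.Tendsto (fun n => qPochInv q (f n)) Filter.atTop
      (nhds (∏' n : ℕ, (1 - q ^ (n + 1)))⁻¹) := by
  have h1 : Filter.Tendsto (fun n => (f n).toNat) Filter.atTop Filter.atTop := by
    refine Filter.tendsto_atTop.mpr fun b => ?_
    filter_upwards [hf.eventually_ge_atTop (b : ℤ)] with n hn
    omega
  refine (((tendsto_qPoch hq).inv₀ (tprod_one_sub_pow_ne_zero hq)).comp h1).congr' ?_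
  filter_upwards [hf.eventually_ge_atTop 0] with n hn
  simp [qPochInv, not_lt.mpr hn]

lemma norm_exp_two_pi_mul_I_lt_one {τ : ℂ} (hτ : 0 < τ.im) : ‖exp (2 * Real.pi * I * τ)‖ < 1 := by
  rw [Complex.norm_exp]
  simp
  positivity

/-- The theta series in the variables `q = e^{2πiτ}` and `ζ = e^{2πiw}` of the triple product. -/
lemma jacobiTheta₂_term_eq_mul_zpow (τ w : ℂ) (j : ℤ) :
    jacobiTheta₂_term j (w + τ / 2 + 1 / 2) τ =
      (-1) ^ j * exp (2 * Real.pi * I * τ) ^ (j * (j + 1) / 2) * exp (2 * Real.pi * I * w) ^ j := by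
  have h : ((j * (j + 1) / 2 : ℤ) : ℂ) = (j * (j + 1)) / 2 := by
    rw [Int.cast_div (Int.even_mul_succ_self j).two_dvd (by norm_num)]; push_cast; ring
  rw [← Complex.exp_pi_mul_I, ← Complex.exp_int_mul, ← Complex.exp_int_mul, ← Complex.exp_int_mul,
    ← Complex.exp_add, ← Complex.exp_add, h, jacobiTheta₂_term]
  congr 1
  ring

/-- The Jacobi triple product, as the limit of the finite one. -/
theorem tendsto_triple_product {τ : ℂ} (hτ : 0 < τ.im) (w : ℂ) :
    Filter.Tendsto (fun n : ℕ => ∏ k ∈ Finset.range n,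
      (1 - exp (2 * Real.pi * I * τ) ^ (k + 1)) *
      ((1 - exp (2 * Real.pi * I * τ) ^ (k + 1) * exp (2 * Real.pi * I * w)) *
        (1 - exp (2 * Real.pi * I * τ) ^ k * (exp (2 * Real.pi * I * w))⁻¹))) Filter.atTop
      (nhds (jacobiTheta₂ (w + τ / 2 + 1 / 2) τ)) := by
  have hq := norm_exp_two_pi_mul_I_lt_one hτ
  have hq0 : exp (2 * Real.pi * I * τ) ≠ 0 := Complex.exp_ne_zero _
  have hs := (summable_jacobiTheta₂_term_iff (w + τ / 2 + 1 / 2) τ).mpr hτ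
  simp_rw [jacobiTheta₂_term_eq_mul_zpow] at hs
  rw [show jacobiTheta₂ (w + τ / 2 + 1 / 2) τ = ∑' j : ℤ, _ from
    tsum_congr (jacobiTheta₂_term_eq_mul_zpow τ w)]
  have hζ : exp (2 * Real.pi * I * w) ≠ 0 := Complex.exp_ne_zero _
  generalize exp (2 * Real.pi * I * τ) = q at *
  generalize exp (2 * Real.pi * I * w) = ζ at *
  obtain ⟨C, hC⟩ := exists_norm_qPoch_le hq
  obtain ⟨D, hD0, hD⟩ := exists_norm_qPochInv_le hq
  have hC0 : 0 ≤ C := (norm_nonneg _).trans (hC 0)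
  have hU := tprod_one_sub_pow_ne_zero hq
  have key := tendsto_tsum_of_dominated_convergence (𝓕 := Filter.atTop)
    (f := fun (n : ℕ) (j : ℤ) => tripleCoeff q n j * ζ ^ j)
    (g := fun j : ℤ => (∏' n : ℕ, (1 - q ^ (n + 1)))⁻¹ * ((-1) ^ j * q ^ (j * (j + 1) / 2) * ζ ^ j))
    (bound := fun j => C * D * D * ‖(-1) ^ j * q ^ (j * (j + 1) / 2) * ζ ^ j‖)
    (hs.norm.mul_left _) ?_ ?_
  · rw [tsum_mul_left] at key
    have key2 := (tendsto_qPoch hq).mul key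
    rw [mul_inv_cancel_left₀ hU] at key2
    refine key2.congr fun n => ?_
    rw [(hasSum_tripleCoeff hq hq0 hζ n).tsum_eq, qPoch, ← Finset.prod_mul_distrib]
  · intro j
    have l1 : Filter.Tendsto (fun n : ℕ => qPoch q (2 * n)) Filter.atTop
        (nhds (∏' n : ℕ, (1 - q ^ (n + 1)))) :=
      (tendsto_qPoch hq).comp (Filter.tendsto_id.const_mul_atTop' (by norm_num))
    have l2 : Filter.Tendsto (fun n : ℕ => (n : ℤ) - j) Filter.atTop Filter.atTop :=
      Filter.tendsto_atTop_add_const_right _ _ tendsto_natCast_atTop_atTop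
    have l3 : Filter.Tendsto (fun n : ℕ => (n : ℤ) + j) Filter.atTop Filter.atTop :=
      Filter.tendsto_atTop_add_const_right _ _ tendsto_natCast_atTop_atTop
    have := ((l1.mul (tendsto_qPochInv hq l2)).mul (tendsto_qPochInv hq l3)).const_mul
      ((-1) ^ j * q ^ (j * (j + 1) / 2) * ζ ^ j)
    rw [mul_inv_cancel₀ hU, one_mul, mul_comm _ (_⁻¹)] at this
    refine this.congr fun n => ?_
    unfold tripleCoeff
    ring
  · refine Filter.Eventually.of_forall fun n j => ?_
    have : tripleCoeff q n j * ζ ^ j = (qPoch q (2 * n) * qPochInv q (n - j) * qPochInv q (n + j)) *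
        ((-1) ^ j * q ^ (j * (j + 1) / 2) * ζ ^ j) := by
      unfold tripleCoeff
      ring
    rw [this, norm_mul, norm_mul, norm_mul]
    gcongr
    · exact hC _
    · exact hD _
    · exact hD _

/-! ### Eta products -/

/-- Sorting the factors `1 - Q^k` with `N m < k ≤ N (m + 1)`, `N = 2 h + 1`, by the pairs of
residues `± r` modulo `N`. -/
lemma prod_range_odd_eq (Q : ℂ) (h m : ℕ) :
    ∏ i ∈ Finset.range (2 * h + 1), (1 - Q ^ ((2 * h + 1) * m + i + 1)) =
      (1 - Q ^ ((2 * h + 1) * (m + 1))) * ∏ r ∈ Finset.range h,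
        ((1 - Q ^ ((2 * h + 1) * m + (2 * h - r))) * (1 - Q ^ ((2 * h + 1) * m + (r + 1)))) := by
  rw [Finset.prod_range_succ, two_mul, Finset.prod_range_add, Finset.prod_mul_distrib,
    ← Finset.prod_range_reflect (fun x => 1 - Q ^ ((h + h + 1) * m + (h + x) + 1)), mul_comm]
  have e1 : (h + h + 1) * m + (h + h) + 1 = (h + h + 1) * (m + 1) := by ring
  rw [e1, mul_comm (∏ x ∈ Finset.range h, (1 - Q ^ ((h + h + 1) * m + x + 1)))]
  congr 2
  refine Finset.prod_congr rfl fun r hr => ?_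
  have := Finset.mem_range.mp hr
  congr 2
  omega

lemma prod_range_mul_odd (Q : ℂ) (h n : ℕ) :
    ∏ k ∈ Finset.range ((2 * h + 1) * n), (1 - Q ^ (k + 1)) =
      (∏ k ∈ Finset.range n, (1 - Q ^ ((2 * h + 1) * (k + 1)))) *
        ∏ r ∈ Finset.range h, ∏ k ∈ Finset.range n,
        ((1 - Q ^ ((2 * h + 1) * k + (2 * h - r))) * (1 - Q ^ ((2 * h + 1) * k + (r + 1)))) := by
  rw [Finset.prod_comm, ← Finset.prod_mul_distrib]
  induction n with
  | zero => simp
  | succ n ih =>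
    rw [Finset.prod_range_succ, ← ih, ← prod_range_odd_eq, mul_add, mul_one,
      Finset.prod_range_add]

/-- The infinite product `∏_{n ≥ 1} (1 - q^n)`, `q = e^{2πiτ}`. -/
def eulerProd (τ : ℂ) : ℂ := ∏' n : ℕ, (1 - exp (2 * Real.pi * I * τ) ^ (n + 1))

lemma eulerProd_ne_zero {τ : ℂ} (hτ : 0 < τ.im) : eulerProd τ ≠ 0 :=
  tprod_one_sub_pow_ne_zero (norm_exp_two_pi_mul_I_lt_one hτ)

lemma eta_eq_exp_mul_eulerProd (τ : ℂ) :
    ModularForm.eta τ = exp (2 * Real.pi * I * τ / 24) * eulerProd τ := by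
  simp [ModularForm.eta, ModularForm.eta_q, eulerProd, Function.Periodic.qParam]

/-- The triple products with `ζ = q^{-r/N}`, `1 ≤ r ≤ (N - 1) / 2`, together run through all
factors of `∏ (1 - q^{k/N})` with `N ∤ k`. -/
theorem prod_jacobiTheta₂_mul_eulerProd {τ : ℂ} (hτ : 0 < τ.im) (h : ℕ) :
    (∏ r ∈ Finset.range h,
      jacobiTheta₂ (-((r + 1 : ℂ) / (2 * h + 1)) * τ + τ / 2 + 1 / 2) τ) * eulerProd τ =
      eulerProd τ ^ h * eulerProd (τ / (2 * h + 1)) := by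
  have hN : ((2 * h + 1 : ℕ) : ℂ) ≠ 0 := by exact_mod_cast Nat.succ_ne_zero (2 * h)
  have hτN : 0 < (τ / (2 * h + 1)).im := by
    have : (τ / (2 * h + 1)) = τ / ((2 * h + 1 : ℝ) : ℂ) := by push_cast; rfl
    rw [this, Complex.div_ofReal_im]
    positivity
  have hq := norm_exp_two_pi_mul_I_lt_one hτ
  have hQ := norm_exp_two_pi_mul_I_lt_one hτN
  set Q := exp (2 * Real.pi * I * (τ / (2 * h + 1))) with hQdef
  have hqQ : exp (2 * Real.pi * I * τ) = Q ^ (2 * h + 1) := by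
    rw [hQdef, ← Complex.exp_nat_mul]
    congr 1
    push_cast at hN ⊢
    field_simp
  have hQ0 : Q ≠ 0 := Complex.exp_ne_zero _
  have l1 := tendsto_finsetProd (Finset.range h) fun (r : ℕ) _ =>
    tendsto_triple_product hτ (-((r + 1 : ℂ) / (2 * h + 1)) * τ)
  have l2 := l1.mul (tendsto_qPoch hq)
  have l3 : Filter.Tendsto (fun n => qPoch Q ((2 * h + 1) * n)) Filter.atTop
      (nhds (∏' n : ℕ, (1 - Q ^ (n + 1)))) :=
    (tendsto_qPoch hQ).comp (Filter.tendsto_id.const_mul_atTop' (by omega))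
  refine tendsto_nhds_unique l2 ((((tendsto_qPoch hq).pow h).mul l3).congr fun n => ?_)
  have hz : ∀ r : ℕ, exp (2 * Real.pi * I * (-((r + 1 : ℂ) / (2 * h + 1)) * τ)) =
      (Q ^ (r + 1))⁻¹ := by
    intro r
    rw [hQdef, ← Complex.exp_nat_mul, ← Complex.exp_neg]
    congr 1
    push_cast
    ring
  simp_rw [hz, inv_inv, hqQ]
  rw [qPoch, qPoch, prod_range_mul_odd, Finset.prod_comm]
  simp_rw [Finset.prod_mul_distrib, Finset.prod_const, Finset.card_range, ← pow_mul]
  rw [Finset.prod_comm (s := Finset.range n), Finset.prod_comm (s := Finset.range n)]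
  have e : ∀ r ∈ Finset.range h, ∏ k ∈ Finset.range n, (1 - Q ^ ((2 * h + 1) * (k + 1)) *
      (Q ^ (r + 1))⁻¹) = ∏ k ∈ Finset.range n, (1 - Q ^ ((2 * h + 1) * k + (2 * h - r))) := by
    intro r hr
    have := Finset.mem_range.mp hr
    refine Finset.prod_congr rfl fun k _ => ?_
    rw [← pow_sub₀ Q hQ0 (by nlinarith)]
    congr 2
    rw [mul_add]
    omega
  rw [Finset.prod_congr rfl e]
  simp_rw [← pow_add]
  ring

/-! ### Theta functions with characteristics -/

/-- The theta function `∑_n (n + α)^ε e^{πi(n + α)²τ + 2πi(n + α)β}` with characteristic `(α, β)`;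
it is used for `ε = 0` (weight `1/2`) and `ε = 1` (weight `3/2`). -/
def thetaCh (ε : ℕ) (α β τ : ℂ) : ℂ :=
  ∑' n : ℤ, (n + α) ^ ε * exp (Real.pi * I * (n + α) ^ 2 * τ + 2 * Real.pi * I * (n + α) * β)

lemma thetaCh_exp_eq (n : ℤ) (α β τ : ℂ) :
    exp (Real.pi * I * (n + α) ^ 2 * τ + 2 * Real.pi * I * (n + α) * β) =
      exp (Real.pi * I * α ^ 2 * τ + 2 * Real.pi * I * α * β) *
        jacobiTheta₂_term n (α * τ + β) τ := by
  rw [jacobiTheta₂_term, ← Complex.exp_add]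
  congr 1
  ring

lemma hasSum_thetaCh_zero {τ : ℂ} (hτ : 0 < τ.im) (α β : ℂ) :
    HasSum (fun n : ℤ => (n + α) ^ 0 *
      exp (Real.pi * I * (n + α) ^ 2 * τ + 2 * Real.pi * I * (n + α) * β))
      (exp (Real.pi * I * α ^ 2 * τ + 2 * Real.pi * I * α * β) * jacobiTheta₂ (α * τ + β) τ) := by
  simp_rw [thetaCh_exp_eq, pow_zero, one_mul]
  exact (hasSum_jacobiTheta₂_term _ hτ).mul_left _

lemma hasSum_thetaCh_one {τ : ℂ} (hτ : 0 < τ.im) (α β : ℂ) :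
    HasSum (fun n : ℤ => (n + α) ^ 1 *
      exp (Real.pi * I * (n + α) ^ 2 * τ + 2 * Real.pi * I * (n + α) * β))
      (exp (Real.pi * I * α ^ 2 * τ + 2 * Real.pi * I * α * β) *
        (jacobiTheta₂' (α * τ + β) τ / (2 * Real.pi * I) + α * jacobiTheta₂ (α * τ + β) τ)) := by
  have h := ((hasSum_jacobiTheta₂'_term (α * τ + β) hτ).div_const (2 * Real.pi * I)).add
    ((hasSum_jacobiTheta₂_term (α * τ + β) hτ).mul_left α)
  convert! h.mul_left (exp (Real.pi * I * α ^ 2 * τ + 2 * Real.pi * I * α * β)) using 2 with n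
  rw [thetaCh_exp_eq, jacobiTheta₂'_term]
  have : (2 * Real.pi * I : ℂ) ≠ 0 := Complex.two_pi_I_ne_zero
  field_simp

lemma thetaCh_zero_eq {τ : ℂ} (hτ : 0 < τ.im) (α β : ℂ) : thetaCh 0 α β τ =
    exp (Real.pi * I * α ^ 2 * τ + 2 * Real.pi * I * α * β) * jacobiTheta₂ (α * τ + β) τ :=
  (hasSum_thetaCh_zero hτ α β).tsum_eq

lemma thetaCh_one_eq {τ : ℂ} (hτ : 0 < τ.im) (α β : ℂ) : thetaCh 1 α β τ =
    exp (Real.pi * I * α ^ 2 * τ + 2 * Real.pi * I * α * β) *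
      (jacobiTheta₂' (α * τ + β) τ / (2 * Real.pi * I) + α * jacobiTheta₂ (α * τ + β) τ) :=
  (hasSum_thetaCh_one hτ α β).tsum_eq

lemma hasSum_thetaCh {ε : ℕ} (hε : ε ≤ 1) {τ : ℂ} (hτ : 0 < τ.im) (α β : ℂ) :
    HasSum (fun n : ℤ => (n + α) ^ ε *
      exp (Real.pi * I * (n + α) ^ 2 * τ + 2 * Real.pi * I * (n + α) * β))
      (thetaCh ε α β τ) := by
  interval_cases ε
  · exact (hasSum_thetaCh_zero hτ α β).summable.hasSum
  · exact (hasSum_thetaCh_one hτ α β).summable.hasSum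

lemma thetaCh_add_one (ε : ℕ) (α β τ : ℂ) : thetaCh ε α β (τ + 1) =
    exp (-(Real.pi * I * (α ^ 2 + α))) * thetaCh ε α (β + α + 1 / 2) τ := by
  unfold thetaCh
  rw [← tsum_mul_left]
  refine tsum_congr fun n => ?_
  obtain ⟨k, hk⟩ : Even (n * (n - 1)) := Int.even_mul_pred_self n
  have h1 : exp (2 * Real.pi * I * k) = 1 := by
    rw [mul_comm]; exact Complex.exp_int_mul_two_pi_mul_I k
  have hk' : (n : ℂ) * (n - 1) = k + k := by exact_mod_cast hk
  rw [mul_left_comm]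
  congr 1
  have h2 : exp (Real.pi * I * (n + α) ^ 2 * (τ + 1) + 2 * Real.pi * I * (n + α) * β) = exp
      (2 * Real.pi * I * k + (-(Real.pi * I * (α ^ 2 + α)) + (Real.pi * I * (n + α) ^ 2 * τ +
        2 * Real.pi * I * (n + α) * (β + α + 1 / 2)))) := by
    congr 1
    linear_combination (Real.pi * I) * hk'
  rw [h2, Complex.exp_add, h1, one_mul, Complex.exp_add]

lemma neg_I_mul_ne_zero {τ : ℂ} (hτ : 0 < τ.im) : -I * τ ≠ 0 := by
  have : τ ≠ 0 := by rintro rfl; simp at hτ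
  simpa using this

lemma neg_one_div_im_pos {τ : ℂ} (hτ : 0 < τ.im) : 0 < (-1 / τ).im := by
  have h0 : τ ≠ 0 := by rintro rfl; simp at hτ
  have := Complex.normSq_pos.mpr h0
  rw [neg_div, one_div, Complex.neg_im, Complex.inv_im]
  rw [neg_div, neg_neg]
  positivity

/-- The inversion formula; the factor `τ ^ ε` appears because the derivative in the elliptic
variable has weight one. -/
lemma thetaCh_neg_one_div {ε : ℕ} (hε : ε ≤ 1) {τ : ℂ} (hτ : 0 < τ.im) (α β : ℂ) :
    thetaCh ε α β (-1 / τ) =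
      τ ^ ε * (-I * τ) ^ (1 / 2 : ℂ) * exp (2 * Real.pi * I * α * β) * thetaCh ε β (-α) τ := by
  have hτ0 : τ ≠ 0 := by rintro rfl; simp at hτ
  have hτ' := neg_one_div_im_pos hτ
  have hz : α * (-1 / τ) + β = (β * τ + -α) / τ := by field_simp; ring
  have hs : (-I * τ) ^ (1 / 2 : ℂ) ≠ 0 := by
    rw [Ne, Complex.cpow_eq_zero_iff]; simp [hτ0]
  have e1 : Complex.exp (Real.pi * I * β ^ 2 * τ + 2 * Real.pi * I * β * -α) *
      Complex.exp (-Real.pi * I * (β * τ + -α) ^ 2 / τ) * Complex.exp (2 * Real.pi * I * α * β) =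
      Complex.exp (Real.pi * I * α ^ 2 * (-1 / τ) + 2 * Real.pi * I * α * β) := by
    rw [← Complex.exp_add, ← Complex.exp_add]
    congr 1
    field_simp
    ring
  have hpi : (2 * Real.pi * I : ℂ) ≠ 0 := Complex.two_pi_I_ne_zero
  interval_cases ε
  · rw [thetaCh_zero_eq hτ', thetaCh_zero_eq hτ, jacobiTheta₂_functional_equation (β * τ + -α) τ,
      ← hz, ← e1]
    field_simp
  · rw [thetaCh_one_eq hτ', thetaCh_one_eq hτ, jacobiTheta₂_functional_equation (β * τ + -α) τ,
      jacobiTheta₂'_functional_equation (β * τ + -α) τ, ← hz, ← e1]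
    generalize jacobiTheta₂' (α * (-1 / τ) + β) (-1 / τ) = A
    generalize jacobiTheta₂ (α * (-1 / τ) + β) (-1 / τ) = B
    generalize Complex.exp (Real.pi * I * β ^ 2 * τ + 2 * Real.pi * I * β * -α) = E1
    generalize Complex.exp (-Real.pi * I * (β * τ + -α) ^ 2 / τ) = E2
    generalize Complex.exp (2 * Real.pi * I * α * β) = E3
    generalize (-I * τ) ^ (1 / 2 : ℂ) = R at *
    generalize (Real.pi : ℂ) = p at *
    have hp : p ≠ 0 := by rintro rfl; simp at hpi
    have hI : (I : ℂ) ≠ 0 := Complex.I_ne_zero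
    generalize I = J at *
    field_simp
    ring

lemma thetaCh_add_intCast_left (ε : ℕ) (α β τ : ℂ) (m : ℤ) :
    thetaCh ε (α + m) β τ = thetaCh ε α β τ := by
  unfold thetaCh
  rw [← (Equiv.addRight m).tsum_eq (fun n : ℤ => (n + α) ^ ε *
    exp (Real.pi * I * (n + α) ^ 2 * τ + 2 * Real.pi * I * (n + α) * β))]
  refine tsum_congr fun n => ?_
  simp only [Equiv.coe_addRight]
  push_cast
  ring_nf

lemma thetaCh_add_intCast_right (ε : ℕ) (α β τ : ℂ) (m : ℤ) :
    thetaCh ε α (β + m) τ = exp (2 * Real.pi * I * α * m) * thetaCh ε α β τ := by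
  unfold thetaCh
  rw [← tsum_mul_left]
  refine tsum_congr fun n => ?_
  have h1 : exp (2 * Real.pi * I * (n * m : ℤ)) = 1 := by
    rw [mul_comm]; exact Complex.exp_int_mul_two_pi_mul_I _
  rw [mul_left_comm, ← Complex.exp_add]
  congr 1
  rw [← mul_one (exp (2 * _ * _ * _ * _ + _)), ← h1, ← Complex.exp_add]
  congr 1
  push_cast
  ring

/-! ### Klein forms and the group `SL₂(ℤ)` -/

/-- The theta function of characteristic `(x + 1/2, y + 1/2)`, normalized so that the modular
group acts on `(x, y)` by right multiplication. -/
def klein (ε : ℕ) (x y τ : ℂ) : ℂ :=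
  exp (-(Real.pi * I * (x * y + x))) * thetaCh ε (x + 1 / 2) (y + 1 / 2) τ

lemma klein_add_one (ε : ℕ) (x y τ : ℂ) :
    klein ε x y (τ + 1) = exp (Real.pi * I / 4) * klein ε x (x + y) τ := by
  have h := thetaCh_add_intCast_right ε (x + 1 / 2) (x + y + 1 / 2) τ 1
  rw [klein, klein, thetaCh_add_one,
    show y + 1 / 2 + (x + 1 / 2) + 1 / 2 = x + y + 1 / 2 + (1 : ℤ) by push_cast; ring, h]
  simp only [← mul_assoc, ← Complex.exp_add]
  congr 2
  push_cast
  ring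

lemma klein_neg_one_div {ε : ℕ} (hε : ε ≤ 1) {τ : ℂ} (hτ : 0 < τ.im) (x y : ℂ) :
    klein ε x y (-1 / τ) =
      -I * (τ ^ ε * (-I * τ) ^ (1 / 2 : ℂ)) * klein ε y (-x) τ := by
  have h := thetaCh_add_intCast_right ε (y + 1 / 2) (-x + 1 / 2) τ (-1)
  rw [klein, klein, thetaCh_neg_one_div hε hτ,
    show -(x + 1 / 2) = -x + 1 / 2 + (-1 : ℤ) by push_cast; ring, h]
  have hI : -I = exp (-(Real.pi * I / 2)) := by
    rw [Complex.exp_neg, show (Real.pi * I / 2 : ℂ) = Real.pi / 2 * I by ring,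
      Complex.exp_pi_div_two_mul_I, Complex.inv_I]
  have e : Complex.exp (-(Real.pi * I * (x * y + x))) *
      Complex.exp (2 * Real.pi * I * (x + 1 / 2) * (y + 1 / 2)) *
      Complex.exp (2 * Real.pi * I * (y + 1 / 2) * (-1 : ℤ)) =
      -I * Complex.exp (-(Real.pi * I * (y * -x + y))) := by
    rw [hI, ← Complex.exp_add, ← Complex.exp_add, ← Complex.exp_add]
    congr 1
    push_cast
    ring
  linear_combination (τ ^ ε * (-I * τ) ^ (1 / 2 : ℂ) * thetaCh ε (y + 1 / 2) (-x + 1 / 2) τ) * e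

lemma klein_add_intCast (ε : ℕ) (x y τ : ℂ) (m n : ℤ) :
    klein ε (x + m) (y + n) τ =
      exp (Real.pi * I * (m + n + m * n + (n * x - m * y))) * klein ε x y τ := by
  rw [klein, klein, show x + m + 1 / 2 = x + 1 / 2 + m by ring,
    show y + n + 1 / 2 = y + 1 / 2 + n by ring, thetaCh_add_intCast_left,
    thetaCh_add_intCast_right]
  have h1 : Complex.exp (2 * Real.pi * I * (-(m + m * n) : ℤ)) = 1 := by
    rw [mul_comm]; exact Complex.exp_int_mul_two_pi_mul_I _
  simp only [← mul_assoc, ← Complex.exp_add]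
  congr 1
  conv_rhs => rw [← mul_one (Complex.exp _), ← h1, ← Complex.exp_add]
  congr 1
  push_cast
  ring

/-- The principal branches satisfy `(-iτ)^{1/2} = τ^{1/2} / i^{1/2}` on the upper half-plane. -/
lemma sqrt_I_inv_mul_sqrt {τ : ℂ} (hτ : 0 < τ.im) :
    (Complex.sqrt I)⁻¹ * Complex.sqrt τ = (-I * τ) ^ (1 / 2 : ℂ) := by
  have h0 : τ ≠ 0 := by rintro rfl; simp at hτ
  have hlog : Complex.log (-I * τ) = Complex.log (-I) + Complex.log τ := by
    rw [Complex.log_mul_eq_add_log_iff (by simp) h0, Complex.arg_neg_I]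
    have h1 : 0 ≤ τ.arg := Complex.arg_nonneg_iff.mpr hτ.le
    have h2 := Complex.arg_le_pi τ
    have := Real.pi_pos
    constructor <;> linarith
  rw [Complex.sqrt, Complex.sqrt, Complex.cpow_def_of_ne_zero (neg_I_mul_ne_zero hτ),
    Complex.cpow_def_of_ne_zero h0, Complex.cpow_def_of_ne_zero Complex.I_ne_zero, hlog,
    ← Complex.exp_neg, ← Complex.exp_add, Complex.log_I, Complex.log_neg_I]
  congr 1
  ring

lemma eta_neg_one_div {τ : ℂ} (hτ : 0 < τ.im) :
    ModularForm.eta (-1 / τ) = (-I * τ) ^ (1 / 2 : ℂ) * ModularForm.eta τ := by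
  have h := ModularForm.eta_comp_eq_csqrt_I_inv hτ
  simp only [Function.comp, Pi.smul_apply, Pi.mul_apply, smul_eq_mul] at h
  rw [h, ← sqrt_I_inv_mul_sqrt hτ, mul_assoc]

lemma eta_add_one (τ : ℂ) :
    ModularForm.eta (τ + 1) = exp (Real.pi * I / 12) * ModularForm.eta τ := by
  have h : ∀ τ : ℂ, eulerProd (τ + 1) = eulerProd τ := by
    intro τ
    have : Complex.exp (2 * Real.pi * I * (τ + 1)) = Complex.exp (2 * Real.pi * I * τ) := by
      rw [mul_add, mul_one, Complex.exp_add, Complex.exp_two_pi_mul_I, mul_one]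
    rw [eulerProd, this, eulerProd]
  rw [eta_eq_exp_mul_eulerProd, eta_eq_exp_mul_eulerProd, h, ← mul_assoc, ← Complex.exp_add]
  congr 2
  ring

lemma cpow_half_sq (z : ℂ) : (z ^ (1 / 2 : ℂ)) ^ 2 = z := by
  rw [one_div]; exact_mod_cast Complex.cpow_nat_inv_pow z (n := 2) (by norm_num)

/-- The weight zero functions obtained from Klein forms by dividing by a power of `η`. For `ε = 0`
these are the Siegel functions up to constants. -/
def siegel (ε : ℕ) (x y τ : ℂ) : ℂ := klein ε x y τ / ModularForm.eta τ ^ (1 + 2 * ε)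

lemma zetaM_twelve_zpow (k : ℤ) : zetaM 12 ^ k = exp (Real.pi * I * k / 6) := by
  rw [zetaM, ← Complex.exp_int_mul]
  congr 1
  push_cast
  ring

lemma zetaM_ne_zero (M : ℕ) : zetaM M ≠ 0 := Complex.exp_ne_zero _

lemma zetaM_zpow_congr {M : ℕ} [NeZero M] {k l : ℤ} (h : k ≡ l [ZMOD M]) :
    zetaM M ^ k = zetaM M ^ l := by
  obtain ⟨j, hj⟩ := h.dvd
  rw [show l = k + M * j by omega, zpow_add₀ (zetaM_ne_zero M), zpow_mul, zpow_natCast,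
    (zetaM_isPrimitiveRoot M).pow_eq_one]
  simp

lemma siegel_add_one (ε : ℕ) (x y τ : ℂ) :
    siegel ε x y (τ + 1) = zetaM 12 ^ ((1 - ε) * 1 : ℤ) * siegel ε x (x + y) τ := by
  rw [siegel, siegel, klein_add_one, eta_add_one, zetaM_twelve_zpow]
  have e : Complex.exp (Real.pi * I / 4) = Complex.exp (Real.pi * I * ((1 - ε) * 1 : ℤ) / 6) *
      Complex.exp (Real.pi * I / 12) ^ (1 + 2 * ε) := by
    rw [← Complex.exp_nat_mul, ← Complex.exp_add]
    congr 1
    push_cast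
    ring
  have := Complex.exp_ne_zero (Real.pi * I / 12)
  rw [e, mul_pow]
  field_simp

lemma siegel_neg_one_div {ε : ℕ} (hε : ε ≤ 1) {τ : ℂ} (hτ : 0 < τ.im) (x y : ℂ) :
    siegel ε x y (-1 / τ) = zetaM 12 ^ ((1 - ε) * 9 : ℤ) * siegel ε y (-x) τ := by
  have hs : (-I * τ) ^ (1 / 2 : ℂ) ≠ 0 := by
    rw [Ne, Complex.cpow_eq_zero_iff]
    simpa using neg_I_mul_ne_zero hτ
  have hsq := cpow_half_sq (-I * τ)
  rw [siegel, siegel, klein_neg_one_div hε hτ, eta_neg_one_div hτ, zetaM_twelve_zpow]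
  have e : -I = Complex.exp (Real.pi * I * 9 / 6) := by
    rw [show (Real.pi * I * 9 / 6 : ℂ) = Real.pi * I + Real.pi / 2 * I by ring, Complex.exp_add,
      Complex.exp_pi_mul_I, Complex.exp_pi_div_two_mul_I]
    ring
  generalize (-I * τ) ^ (1 / 2 : ℂ) = R at *
  rw [mul_pow, pow_add R, pow_mul, hsq]
  have hIτ : -I * τ ≠ 0 := neg_I_mul_ne_zero hτ
  interval_cases ε
  · norm_num
    rw [← e]
    field_simp
  · norm_num
    have hτ0 : τ ≠ 0 := by rintro rfl; simp at hτ
    field_simp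

/-- The exponent of the character of `SL₂(ℤ)` by which `η²` transforms:
`η²(γτ) = e^{2πi ℓ(γ)/12} (cτ + d) η²(τ)`. Only its class modulo `12` matters; the closed formula is
a polynomial representative. -/
def ell (γ : Matrix.SpecialLinearGroup (Fin 2) ℤ) : ℤ :=
  (1 - γ 1 0 ^ 2) * (γ 0 1 * γ 1 1 + 3 * (γ 1 0 - 1) * γ 1 1 + γ 1 0 + 3)
    + γ 1 0 * (γ 0 0 + γ 1 1 - 3)

/-- A congruence modulo `12` follows from those modulo `3` and `4`. -/
lemma modEq_twelve_of_zmod {x y : ℤ} (h3 : (x : ZMod 3) = y) (h4 : (x : ZMod 4) = y) :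
    x ≡ y [ZMOD 12] := by
  have h3' := (ZMod.intCast_eq_intCast_iff _ _ _).mp h3
  have h4' := (ZMod.intCast_eq_intCast_iff _ _ _).mp h4
  simp only [Int.ModEq] at *
  omega

lemma det_eq (γ : Matrix.SpecialLinearGroup (Fin 2) ℤ) :
    γ 0 0 * γ 1 1 - γ 0 1 * γ 1 0 = 1 := by
  rw [← Matrix.det_fin_two]; exact γ.2

lemma S_mul_apply (γ : Matrix.SpecialLinearGroup (Fin 2) ℤ) :
    (ModularGroup.S * γ) 0 0 = -γ 1 0 ∧ (ModularGroup.S * γ) 0 1 = -γ 1 1 ∧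
      (ModularGroup.S * γ) 1 0 = γ 0 0 ∧ (ModularGroup.S * γ) 1 1 = γ 0 1 := by
  simp [Matrix.SpecialLinearGroup.coe_mul, ModularGroup.coe_S, Matrix.mul_apply, Fin.sum_univ_two]

lemma T_mul_apply (γ : Matrix.SpecialLinearGroup (Fin 2) ℤ) :
    (ModularGroup.T * γ) 0 0 = γ 0 0 + γ 1 0 ∧ (ModularGroup.T * γ) 0 1 = γ 0 1 + γ 1 1 ∧
      (ModularGroup.T * γ) 1 0 = γ 1 0 ∧ (ModularGroup.T * γ) 1 1 = γ 1 1 := by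
  simp [Matrix.SpecialLinearGroup.coe_mul, ModularGroup.coe_T, Matrix.mul_apply, Fin.sum_univ_two]

/-- The cocycle relation for the generator `T`, a finite verification modulo `3` and modulo `4`. -/
lemma ell_T_mul (γ : Matrix.SpecialLinearGroup (Fin 2) ℤ) :
    ell (ModularGroup.T * γ) ≡ 1 + ell γ [ZMOD 12] := by
  have hdet := det_eq γ
  obtain ⟨h1, h2, h3, h4⟩ := T_mul_apply γ
  simp only [ell, h1, h2, h3, h4]
  clear h1 h2 h3 h4
  generalize γ 0 0 = a at *
  generalize γ 0 1 = b at *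
  generalize γ 1 0 = c at *
  generalize γ 1 1 = d at *
  refine modEq_twelve_of_zmod ?_ ?_
  · have h := congrArg (Int.cast : ℤ → ZMod 3) hdet
    push_cast at h ⊢
    revert h
    generalize (a : ZMod 3) = a
    generalize (b : ZMod 3) = b
    generalize (c : ZMod 3) = c
    generalize (d : ZMod 3) = d
    revert a b c d
    decide
  · have h := congrArg (Int.cast : ℤ → ZMod 4) hdet
    push_cast at h ⊢
    revert h
    generalize (a : ZMod 4) = a
    generalize (b : ZMod 4) = b
    generalize (c : ZMod 4) = c
    generalize (d : ZMod 4) = d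
    revert a b c d
    decide

/-- The cocycle relation for the generator `S`, a finite verification modulo `3` and modulo `4`. -/
lemma ell_S_mul (γ : Matrix.SpecialLinearGroup (Fin 2) ℤ) :
    ell (ModularGroup.S * γ) ≡ 9 + ell γ [ZMOD 12] := by
  have hdet := det_eq γ
  obtain ⟨h1, h2, h3, h4⟩ := S_mul_apply γ
  simp only [ell, h1, h2, h3, h4]
  clear h1 h2 h3 h4
  generalize γ 0 0 = a at *
  generalize γ 0 1 = b at *
  generalize γ 1 0 = c at *
  generalize γ 1 1 = d at *
  refine modEq_twelve_of_zmod ?_ ?_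
  · have h := congrArg (Int.cast : ℤ → ZMod 3) hdet
    push_cast at h ⊢
    revert h
    generalize (a : ZMod 3) = a
    generalize (b : ZMod 3) = b
    generalize (c : ZMod 3) = c
    generalize (d : ZMod 3) = d
    revert a b c d
    decide
  · have h := congrArg (Int.cast : ℤ → ZMod 4) hdet
    push_cast at h ⊢
    revert h
    generalize (a : ZMod 4) = a
    generalize (b : ZMod 4) = b
    generalize (c : ZMod 4) = c
    generalize (d : ZMod 4) = d
    revert a b c d
    decide

/-- Induction on words in the generators `S` and `T`; the equivalences take care of inverses. -/
lemma SL2Z_induction {P : Matrix.SpecialLinearGroup (Fin 2) ℤ → Prop} (h1 : P 1)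
    (hS : ∀ γ, P (ModularGroup.S * γ) ↔ P γ) (hT : ∀ γ, P (ModularGroup.T * γ) ↔ P γ)
    (γ : Matrix.SpecialLinearGroup (Fin 2) ℤ) : P γ := by
  have hγ : γ ∈ Subgroup.closure {ModularGroup.S, ModularGroup.T} := by
    simp [SpecialLinearGroup.SL2Z_generators]
  refine Subgroup.closure_induction_left (p := fun g _ => P g) h1 ?_ ?_ hγ
  · rintro x (rfl | rfl) y - hy
    · exact (hS y).mpr hy
    · exact (hT y).mpr hy
  · rintro x (rfl | rfl) y - hy
    · rw [← hS]; simpa using hy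
    · rw [← hT]; simpa using hy

lemma coe_smul_eq (γ : Matrix.SpecialLinearGroup (Fin 2) ℤ) (τ : ℍ) :
    ((γ • τ : ℍ) : ℂ) = (γ 0 0 * τ + γ 0 1) / (γ 1 0 * τ + γ 1 1) := by
  rw [UpperHalfPlane.coe_specialLinearGroup_apply]
  simp

lemma coe_S_smul (τ : ℍ) : ((ModularGroup.S • τ : ℍ) : ℂ) = -1 / τ := by
  rw [coe_smul_eq]; simp [ModularGroup.S]

lemma coe_T_smul (τ : ℍ) : ((ModularGroup.T • τ : ℍ) : ℂ) = τ + 1 := by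
  rw [coe_smul_eq]; simp [ModularGroup.T]

/-- The action of the modular group on the functions `siegel ε x y`. -/
theorem siegel_smul {ε : ℕ} (hε : ε ≤ 1) (γ : Matrix.SpecialLinearGroup (Fin 2) ℤ) :
    ∀ (x y : ℂ) (τ : ℍ), siegel ε x y (γ • τ : ℍ) = zetaM 12 ^ ((1 - ε) * ell γ) *
      siegel ε (x * γ 0 0 + y * γ 1 0) (x * γ 0 1 + y * γ 1 1) τ := by
  have hz := zetaM_ne_zero 12
  induction γ using SL2Z_induction with
  | h1 => intro x y τ; simp [ell]
  | hS γ =>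
    have e : zetaM 12 ^ ((1 - ε) * ell (ModularGroup.S * γ)) =
        zetaM 12 ^ ((1 - ε) * 9 : ℤ) * zetaM 12 ^ ((1 - ε) * ell γ) := by
      rw [← zpow_add₀ hz, ← mul_add]
      exact zetaM_zpow_congr ((ell_S_mul γ).mul_left _)
    have key : ∀ (x y : ℂ) (τ : ℍ), siegel ε x y (((ModularGroup.S * γ) • τ : ℍ)) =
        zetaM 12 ^ ((1 - ε) * ell (ModularGroup.S * γ)) *
        siegel ε (x * (ModularGroup.S * γ) 0 0 + y * (ModularGroup.S * γ) 1 0)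
          (x * (ModularGroup.S * γ) 0 1 + y * (ModularGroup.S * γ) 1 1) τ ↔
        siegel ε y (-x) (γ • τ : ℍ) = zetaM 12 ^ ((1 - ε) * ell γ) *
          siegel ε (y * γ 0 0 + -x * γ 1 0) (y * γ 0 1 + -x * γ 1 1) τ := by
      intro x y τ
      rw [mul_smul, coe_S_smul, siegel_neg_one_div hε (γ • τ).im_pos, e, mul_assoc]
      have := mul_right_injective₀ (zpow_ne_zero ((1 - ε) * 9 : ℤ) hz)
      rw [this.eq_iff]
      have e1 : (x * (ModularGroup.S * γ) 0 0 + y * (ModularGroup.S * γ) 1 0 : ℂ) =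
          y * γ 0 0 + -x * γ 1 0 := by
        obtain ⟨h1, h2, h3, h4⟩ := S_mul_apply γ
        rw [h1, h3]
        push_cast
        ring
      have e2 : (x * (ModularGroup.S * γ) 0 1 + y * (ModularGroup.S * γ) 1 1 : ℂ) =
          y * γ 0 1 + -x * γ 1 1 := by
        obtain ⟨h1, h2, h3, h4⟩ := S_mul_apply γ
        rw [h2, h4]
        push_cast
        ring
      rw [e1, e2]
    simp_rw [key]
    -- both directions, since `(x, y) ↦ (y, -x)` is a bijection of the characteristics
    exact ⟨fun h x y τ => by simpa using h (-y) x τ, fun h x y τ => h y (-x) τ⟩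
  | hT γ =>
    have e : zetaM 12 ^ ((1 - ε) * ell (ModularGroup.T * γ)) =
        zetaM 12 ^ ((1 - ε) * 1 : ℤ) * zetaM 12 ^ ((1 - ε) * ell γ) := by
      rw [← zpow_add₀ hz, ← mul_add]
      exact zetaM_zpow_congr ((ell_T_mul γ).mul_left _)
    have key : ∀ (x y : ℂ) (τ : ℍ), siegel ε x y (((ModularGroup.T * γ) • τ : ℍ)) =
        zetaM 12 ^ ((1 - ε) * ell (ModularGroup.T * γ)) *
        siegel ε (x * (ModularGroup.T * γ) 0 0 + y * (ModularGroup.T * γ) 1 0)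
          (x * (ModularGroup.T * γ) 0 1 + y * (ModularGroup.T * γ) 1 1) τ ↔
        siegel ε x (x + y) (γ • τ : ℍ) = zetaM 12 ^ ((1 - ε) * ell γ) *
          siegel ε (x * γ 0 0 + (x + y) * γ 1 0) (x * γ 0 1 + (x + y) * γ 1 1) τ := by
      intro x y τ
      rw [mul_smul, coe_T_smul, siegel_add_one, e, mul_assoc]
      have := mul_right_injective₀ (zpow_ne_zero ((1 - ε) * 1 : ℤ) hz)
      rw [this.eq_iff]
      have e1 : (x * (ModularGroup.T * γ) 0 0 + y * (ModularGroup.T * γ) 1 0 : ℂ) =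
          x * γ 0 0 + (x + y) * γ 1 0 := by
        obtain ⟨h1, h2, h3, h4⟩ := T_mul_apply γ
        rw [h1, h3]
        push_cast
        ring
      have e2 : (x * (ModularGroup.T * γ) 0 1 + y * (ModularGroup.T * γ) 1 1 : ℂ) =
          x * γ 0 1 + (x + y) * γ 1 1 := by
        obtain ⟨h1, h2, h3, h4⟩ := T_mul_apply γ
        rw [h2, h4]
        push_cast
        ring
      rw [e1, e2]
    simp_rw [key]
    exact ⟨fun h x y τ => by simpa using h x (y - x) τ, fun h x y τ => h x (x + y) τ⟩

lemma denom_ne_zero' (γ : Matrix.SpecialLinearGroup (Fin 2) ℤ) (τ : ℍ) :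
    (γ 1 0 * τ + γ 1 1 : ℂ) ≠ 0 := by
  have := UpperHalfPlane.denom_ne_zero
    (γ : GL (Fin 2) ℝ) τ
  simpa [UpperHalfPlane.denom] using this

/-- Passing to the square removes the square root of `cτ + d` from the transformation of `η`. -/
theorem eta_sq_smul (γ : Matrix.SpecialLinearGroup (Fin 2) ℤ) :
    ∀ τ : ℍ, ModularForm.eta (γ • τ : ℍ) ^ 2 =
      zetaM 12 ^ ell γ * (γ 1 0 * τ + γ 1 1) * ModularForm.eta τ ^ 2 := by
  have hz := zetaM_ne_zero 12
  induction γ using SL2Z_induction with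
  | h1 => intro τ; simp [ell]
  | hS γ =>
    refine forall_congr' fun τ => ?_
    have hc := denom_ne_zero' γ τ
    have h9 : zetaM 12 ^ (9 : ℤ) = -I := by
      rw [zetaM_twelve_zpow, show (Real.pi * I * (9 : ℤ) / 6 : ℂ) = Real.pi * I + Real.pi / 2 * I by
        push_cast; ring, Complex.exp_add, Complex.exp_pi_mul_I, Complex.exp_pi_div_two_mul_I]
      ring
    have e : zetaM 12 ^ ell (ModularGroup.S * γ) = -I * zetaM 12 ^ ell γ := by
      rw [← h9, ← zpow_add₀ hz]
      exact zetaM_zpow_congr (ell_S_mul γ)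
    have e1 : (((ModularGroup.S * γ) 1 0 : ℤ) * τ + ((ModularGroup.S * γ) 1 1 : ℤ) : ℂ) =
        ((γ • τ : ℍ) : ℂ) * (γ 1 0 * τ + γ 1 1) := by
      rw [coe_smul_eq, div_mul_cancel₀ _ hc]
      obtain ⟨-, -, h3, h4⟩ := S_mul_apply γ
      rw [h3, h4]
    rw [mul_smul, coe_S_smul, eta_neg_one_div (γ • τ).im_pos, mul_pow, cpow_half_sq, e, e1]
    have h0 := neg_I_mul_ne_zero (γ • τ).im_pos
    rw [← mul_right_injective₀ h0 |>.eq_iff (a := ModularForm.eta (γ • τ : ℍ) ^ 2)]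
    ring_nf
  | hT γ =>
    refine forall_congr' fun τ => ?_
    have e : zetaM 12 ^ ell (ModularGroup.T * γ) = zetaM 12 * zetaM 12 ^ ell γ := by
      rw [← zpow_one_add₀ hz]
      exact zetaM_zpow_congr (ell_T_mul γ)
    have e1 : (((ModularGroup.T * γ) 1 0 : ℤ) * τ + ((ModularGroup.T * γ) 1 1 : ℤ) : ℂ) =
        (γ 1 0 * τ + γ 1 1) := by
      obtain ⟨-, -, h3, h4⟩ := T_mul_apply γ
      rw [h3, h4]
    have e2 : Complex.exp (Real.pi * I / 12) ^ 2 = zetaM 12 := by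
      rw [zetaM, ← Complex.exp_nat_mul]; congr 1; push_cast; ring
    rw [mul_smul, coe_T_smul, eta_add_one, mul_pow, e, e1, e2]
    rw [← mul_right_injective₀ hz |>.eq_iff (a := ModularForm.eta (γ • τ : ℍ) ^ 2)]
    ring_nf

/-! ### Laurent expansions in `q^{1/M}` -/

/-- The local parameter `q_M = e^{2πiτ/M}` at `i∞`. -/
def qLocal (M : ℕ) (τ : ℂ) : ℂ := exp (2 * Real.pi * I * τ / M)

lemma qLocal_ne_zero (M : ℕ) (τ : ℂ) : qLocal M τ ≠ 0 := Complex.exp_ne_zero _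

lemma qLocal_eq_qParam (M : ℕ) (τ : ℂ) : qLocal M τ = Function.Periodic.qParam M τ := by
  simp [qLocal, Function.Periodic.qParam]

lemma qLocal_zpow (M : ℕ) (τ : ℂ) (k : ℤ) :
    qLocal M τ ^ k = exp (2 * Real.pi * I * k * τ / M) := by
  rw [qLocal, ← Complex.exp_int_mul]
  congr 1
  ring

lemma eventually_exists_qLocal_eq (M : ℕ) [NeZero M] (Y : ℝ) :
    ∀ᶠ q in nhdsWithin (0 : ℂ) {0}ᶜ, ∃ τ : ℍ, Y < τ.im ∧ qLocal M τ = q := by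
  have hM : (0 : ℝ) < M := by exact_mod_cast NeZero.pos M
  have h := Function.Periodic.invQParam_tendsto hM
  have h2 : ∀ᶠ z : ℂ in Filter.comap Complex.im Filter.atTop, max Y 0 < z.im :=
    Filter.tendsto_comap.eventually (Filter.eventually_gt_atTop _)
  filter_upwards [h.eventually h2, self_mem_nhdsWithin] with q hq hq0
  refine ⟨⟨Function.Periodic.invQParam M q, (le_max_right _ _).trans_lt hq⟩,
    (le_max_left _ _).trans_lt hq, ?_⟩
  rw [qLocal_eq_qParam]
  exact Function.Periodic.qParam_right_inv hM.ne' hq0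

lemma exists_forall_im_gt_of_eventually (M : ℕ) [NeZero M] {P : ℂ → Prop}
    (h : ∀ᶠ q in nhdsWithin (0 : ℂ) {0}ᶜ, P q) :
    ∃ Y : ℝ, ∀ τ : ℍ, Y < τ.im → P (qLocal M τ) := by
  have hM : (0 : ℝ) < M := by exact_mod_cast NeZero.pos M
  have h1 := (Function.Periodic.qParam_tendsto hM).eventually h
  rw [Filter.eventually_comap] at h1
  obtain ⟨Y, hY⟩ := Filter.eventually_atTop.mp h1
  exact ⟨Y, fun τ hτ => by rw [qLocal_eq_qParam]; exact hY _ hτ.le _ rfl⟩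

lemma HasFourierExpansion.hasSum {M : ℕ} {f : ℍ → ℂ} {c : LaurentSeries ℂ}
    (h : HasFourierExpansion M f c) : ∃ Y : ℝ, ∀ τ : ℍ, Y < τ.im →
      HasSum (fun k : ℤ => c.coeff k * qLocal M τ ^ k) (f τ) := by
  simp_rw [qLocal_zpow]; exact h

lemma hasFourierExpansion_iff {M : ℕ} {f : ℍ → ℂ} {c : LaurentSeries ℂ} :
    HasFourierExpansion M f c ↔ ∃ Y : ℝ, ∀ τ : ℍ, Y < τ.im →
      HasSum (fun k : ℤ => c.coeff k * qLocal M τ ^ k) (f τ) := by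
  simp_rw [qLocal_zpow]; rfl

/-- A Laurent series without terms of exponent below `n` that converges near `0` is `q ^ n` times
a convergent power series. -/
lemma hasFPowerSeriesAt_of_laurent {c : ℤ → ℂ} {n : ℤ} (hn : ∀ k < n, c k = 0)
    (h : ∀ᶠ q in nhdsWithin (0 : ℂ) {0}ᶜ, Summable fun k : ℤ => c k * q ^ k) :
    HasFPowerSeriesAt (fun q : ℂ => ∑' j : ℕ, q ^ j • c (n + j))
      (FormalMultilinearSeries.ofScalars ℂ fun j : ℕ => c (n + j)) 0 ∧
    ∀ᶠ q in nhdsWithin (0 : ℂ) {0}ᶜ,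
      ∑' k : ℤ, c k * q ^ k = q ^ n * ∑' j : ℕ, q ^ j • c (n + j) := by
  have hinj : Function.Injective fun j : ℕ => n + (j : ℤ) := fun a b hab => by simpa using hab
  have hz : ∀ q : ℂ, ∀ x ∉ Set.range (fun j : ℕ => n + (j : ℤ)), c x * q ^ x = 0 := by
    intro q x hx
    rw [hn x, zero_mul]
    by_contra hlt
    exact hx ⟨(x - n).toNat, by simp only; omega⟩
  have h1 : ∀ᶠ q in nhdsWithin (0 : ℂ) {0}ᶜ,
      HasSum (fun j : ℕ => q ^ j • c (n + j)) ((q ^ n)⁻¹ * ∑' k : ℤ, c k * q ^ k) := by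
    filter_upwards [h, self_mem_nhdsWithin] with q hq hq0
    have hq0' : q ≠ 0 := hq0
    have := ((hinj.hasSum_iff (hz q)).mpr hq.hasSum).mul_left (q ^ n)⁻¹
    refine this.congr_fun ?_
    intro j
    simp only [Function.comp, smul_eq_mul, zpow_add₀ hq0', zpow_natCast]
    have := zpow_ne_zero n hq0'
    field_simp
  refine ⟨hasFPowerSeriesAt_iff.mpr ?_, ?_⟩
  · rw [eventually_nhdsWithin_iff] at h1
    filter_upwards [h1] with q hq
    simp only [FormalMultilinearSeries.coeff_ofScalars, zero_add]
    rcases eq_or_ne q 0 with rfl | hq0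
    · refine (summable_of_ne_finset_zero (s := {0}) fun j hj => ?_).hasSum
      simp only [Finset.mem_singleton] at hj
      simp [hj]
    · exact (hq hq0).summable.hasSum
  · filter_upwards [h1, self_mem_nhdsWithin] with q hq hq0
    rw [hq.tsum_eq, mul_inv_cancel_left₀ (zpow_ne_zero n hq0)]

/-- `f` is, near `i∞`, a meromorphic function of `q_M`. -/
def IsMeroAtInfty (M : ℕ) (f : ℍ → ℂ) : Prop :=
  ∃ F : ℂ → ℂ, MeromorphicAt F 0 ∧ ∃ Y : ℝ, ∀ τ : ℍ, Y < τ.im → f τ = F (qLocal M τ)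

namespace IsMeroAtInfty

variable {M : ℕ} {f g : ℍ → ℂ}

lemma const (M : ℕ) (a : ℂ) : IsMeroAtInfty M fun _ => a :=
  ⟨fun _ => a, MeromorphicAt.const a 0, 0, fun _ _ => rfl⟩

lemma add (hf : IsMeroAtInfty M f) (hg : IsMeroAtInfty M g) :
    IsMeroAtInfty M fun τ => f τ + g τ := by
  obtain ⟨F, hF, Y, hY⟩ := hf
  obtain ⟨G, hG, Z, hZ⟩ := hg
  exact ⟨F + G, hF.add hG, max Y Z, fun τ h => by
    beta_reduce
    rw [hY τ ((le_max_left _ _).trans_lt h), hZ τ ((le_max_right _ _).trans_lt h)]; rfl⟩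

lemma mul (hf : IsMeroAtInfty M f) (hg : IsMeroAtInfty M g) :
    IsMeroAtInfty M fun τ => f τ * g τ := by
  obtain ⟨F, hF, Y, hY⟩ := hf
  obtain ⟨G, hG, Z, hZ⟩ := hg
  exact ⟨F * G, hF.mul hG, max Y Z, fun τ h => by
    beta_reduce
    rw [hY τ ((le_max_left _ _).trans_lt h), hZ τ ((le_max_right _ _).trans_lt h)]; rfl⟩

lemma inv (hf : IsMeroAtInfty M f) : IsMeroAtInfty M fun τ => (f τ)⁻¹ := by
  obtain ⟨F, hF, Y, hY⟩ := hf
  exact ⟨F⁻¹, hF.inv, Y, fun τ h => by beta_reduce; rw [hY τ h]; rfl⟩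

lemma div (hf : IsMeroAtInfty M f) (hg : IsMeroAtInfty M g) :
    IsMeroAtInfty M fun τ => f τ / g τ := by
  simpa only [div_eq_mul_inv] using hf.mul hg.inv

lemma pow (hf : IsMeroAtInfty M f) (n : ℕ) : IsMeroAtInfty M fun τ => f τ ^ n := by
  obtain ⟨F, hF, Y, hY⟩ := hf
  exact ⟨F ^ n, hF.pow n, Y, fun τ h => by beta_reduce; rw [hY τ h]; rfl⟩

lemma sum {ι : Type*} {s : Finset ι} {f : ι → ℍ → ℂ} (h : ∀ i ∈ s, IsMeroAtInfty M (f i)) :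
    IsMeroAtInfty M fun τ => ∑ i ∈ s, f i τ := by
  classical
  induction s using Finset.induction_on with
  | empty => simpa using const M 0
  | insert i s hi ih =>
    simp only [Finset.sum_insert hi]
    exact (h i (Finset.mem_insert_self i s)).add
      (ih fun j hj => h j (Finset.mem_insert_of_mem hj))

lemma prod {ι : Type*} {s : Finset ι} {f : ι → ℍ → ℂ} (h : ∀ i ∈ s, IsMeroAtInfty M (f i)) :
    IsMeroAtInfty M fun τ => ∏ i ∈ s, f i τ := by
  classical
  induction s using Finset.induction_on with
  | empty => simpa using const M 1
  | insert i s hi ih =>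
    simp only [Finset.prod_insert hi]
    exact (h i (Finset.mem_insert_self i s)).mul
      (ih fun j hj => h j (Finset.mem_insert_of_mem hj))

/-- A function meromorphic in `q_M` at `0` has a Laurent expansion: the power series of `q^n F(q)`,
for `n` large, shifted by `n`. -/
lemma exists_hasFourierExpansion [NeZero M] (hf : IsMeroAtInfty M f) :
    ∃ c : LaurentSeries ℂ, HasFourierExpansion M f c := by
  obtain ⟨F, ⟨n, p, hp⟩, Y, hY⟩ := hf
  have hp' := hasFPowerSeriesAt_iff.mp ⟨_, hp.choose_spec⟩
  set c : ℤ → ℂ := fun k => if k < -n then 0 else p.coeff (k + n).toNat with hc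
  have hsupp : BddBelow (Function.support c) := by
    refine ⟨-n, fun k hk => ?_⟩
    by_contra hlt
    exact hk (by simp [hc, not_le.mp hlt])
  refine ⟨HahnSeries.ofSuppBddBelow c hsupp, hasFourierExpansion_iff.mpr ?_⟩
  have h2 : ∀ᶠ q in nhdsWithin (0 : ℂ) {0}ᶜ, HasSum (fun k : ℤ => c k * q ^ k) (F q) := by
    filter_upwards [nhdsWithin_le_nhds hp', self_mem_nhdsWithin] with q hq hq0
    have hq0' : q ≠ 0 := hq0
    have hinj : Function.Injective fun j : ℕ => -(n : ℤ) + (j : ℤ) := fun a b hab => by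
      simpa using hab
    refine (hinj.hasSum_iff fun k hk => ?_).mp ?_
    · have : c k = 0 := by
        rw [hc]
        simp only
        rw [if_pos]
        by_contra hlt
        exact hk ⟨(k + n).toNat, by simp only; omega⟩
      rw [this, zero_mul]
    · have h3 := hq.mul_left (q ^ (-n : ℤ))
      have hF : q ^ (-n : ℤ) * ((0 + q - 0) ^ n • F (0 + q)) = F q := by
        rw [zero_add, sub_zero, smul_eq_mul, zpow_neg, zpow_natCast,
          inv_mul_cancel_left₀ (pow_ne_zero n hq0')]
      rw [hF] at h3
      refine h3.congr_fun fun j => ?_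
      have e : (-(n : ℤ) + j + n).toNat = j := by omega
      simp only [Function.comp, hc, smul_eq_mul, e, show ¬ (-(n : ℤ) + j < -n) by omega, if_false,
        zpow_add₀ hq0', zpow_natCast]
      ring
  obtain ⟨Z, hZ⟩ := exists_forall_im_gt_of_eventually M h2
  exact ⟨max Y Z, fun τ h => by
    rw [hY τ ((le_max_left _ _).trans_lt h)]
    exact hZ τ ((le_max_right _ _).trans_lt h)⟩

end IsMeroAtInfty

/-- The product of two absolutely convergent series over `ℤ`, summed along the lines
`i + j = k`. -/
lemma hasSum_mul_int {f g s : ℤ → ℂ} {a b : ℂ} (hf : HasSum f a) (hg : HasSum g b)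
    (hs : ∀ k, HasSum (fun i => f i * g (k - i)) (s k)) : HasSum s (a * b) := by
  let e : ℤ × ℤ ≃ ℤ × ℤ :=
    { toFun := fun x => (x.2, x.1 - x.2)
      invFun := fun x => (x.1 + x.2, x.1)
      left_inv := fun x => by simp
      right_inv := fun x => by simp }
  have h1 : Summable fun x : ℤ × ℤ => f x.1 * g x.2 :=
    summable_mul_of_summable_norm hf.summable.norm hg.summable.norm
  have h2 : HasSum (fun x : ℤ × ℤ => f x.1 * g x.2) (a * b) := hf.mul hg h1
  have h3 : HasSum ((fun x : ℤ × ℤ => f x.1 * g x.2) ∘ e) (a * b) := e.hasSum_iff.mpr h2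
  exact h3.prod_fiberwise hs

/-- The coefficients of a product of Laurent series, as sums over all of `ℤ`. -/
lemma hasSum_coeff_mul (c d : LaurentSeries ℂ) {q : ℂ} (hq : q ≠ 0) (k : ℤ) :
    HasSum (fun i : ℤ => c.coeff i * q ^ i * (d.coeff (k - i) * q ^ (k - i)))
      ((c * d).coeff k * q ^ k) := by
  have hinj : Set.InjOn Prod.fst
      (Finset.antidiagonal c.isPWO_support d.isPWO_support k : Set (ℤ × ℤ)) := by
    intro a ha b hb hab
    have h6 := (Finset.mem_antidiagonal.mp ha).2.2
    have h7 := (Finset.mem_antidiagonal.mp hb).2.2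
    refine Prod.ext hab ?_
    omega
  have hval : (c * d).coeff k * q ^ k =
      ∑ i ∈ (Finset.antidiagonal c.isPWO_support d.isPWO_support k).image Prod.fst,
        c.coeff i * q ^ i * (d.coeff (k - i) * q ^ (k - i)) := by
    rw [Finset.sum_image hinj, HahnSeries.coeff_mul, Finset.sum_mul]
    refine Finset.sum_congr rfl fun ij hij => ?_
    have := (Finset.mem_antidiagonal.mp hij).2.2
    rw [← this, add_sub_cancel_left, zpow_add₀ hq]
    ring
  rw [hval]
  refine hasSum_sum_of_ne_finset_zero fun i hi => ?_
  by_contra hne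
  refine hi (Finset.mem_image.mpr ⟨(i, k - i), ?_, rfl⟩)
  rw [Finset.mem_antidiagonal]
  refine ⟨fun h0 => hne ?_, fun h0 => hne ?_, by simp⟩
  · simp [h0]
  · simp [h0]

namespace HasFourierExpansion

variable {M : ℕ} {f g : ℍ → ℂ} {c d : LaurentSeries ℂ}

lemma eventually_summable [NeZero M] (h : HasFourierExpansion M f c) :
    ∀ᶠ q in nhdsWithin (0 : ℂ) {0}ᶜ, Summable fun k : ℤ => c.coeff k * q ^ k := by
  obtain ⟨Y, hY⟩ := h.hasSum
  filter_upwards [eventually_exists_qLocal_eq M Y] with q hq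
  obtain ⟨τ, hτ, rfl⟩ := hq
  exact (hY τ hτ).summable

/-- A convergent Laurent expansion defines a meromorphic function of `q_M`. -/
lemma isMeroAtInfty [NeZero M] (h : HasFourierExpansion M f c) : IsMeroAtInfty M f := by
  obtain ⟨Y, hY⟩ := h.hasSum
  refine ⟨fun q => ∑' k : ℤ, c.coeff k * q ^ k, ?_, Y, fun τ hτ => (hY τ hτ).tsum_eq.symm⟩
  obtain ⟨h1, h2⟩ := hasFPowerSeriesAt_of_laurent (n := c.order)
    (fun k hk => HahnSeries.coeff_eq_zero_of_lt_order hk) h.eventually_summable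
  have h3 : MeromorphicAt (fun q : ℂ => q ^ c.order * ∑' j : ℕ, q ^ j • c.coeff (c.order + j)) 0 :=
    ((MeromorphicAt.id 0).zpow c.order).mul h1.analyticAt.meromorphicAt
  exact h3.congr (h2.mono fun q hq => hq.symm)

lemma sub (hf : HasFourierExpansion M f c) (hg : HasFourierExpansion M g d) :
    HasFourierExpansion M (fun τ => f τ - g τ) (c - d) := by
  obtain ⟨Y, hY⟩ := hf
  obtain ⟨Z, hZ⟩ := hg
  refine ⟨max Y Z, fun τ h => ?_⟩
  have := (hY τ ((le_max_left _ _).trans_lt h)).sub (hZ τ ((le_max_right _ _).trans_lt h))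
  simpa only [HahnSeries.coeff_sub, sub_mul] using this

lemma mul (hf : HasFourierExpansion M f c) (hg : HasFourierExpansion M g d) :
    HasFourierExpansion M (fun τ => f τ * g τ) (c * d) := by
  obtain ⟨Y, hY⟩ := hf.hasSum
  obtain ⟨Z, hZ⟩ := hg.hasSum
  refine hasFourierExpansion_iff.mpr ⟨max Y Z, fun τ h => ?_⟩
  have h1 := hY τ ((le_max_left _ _).trans_lt h)
  have h2 := hZ τ ((le_max_right _ _).trans_lt h)
  exact hasSum_mul_int h1 h2 (hasSum_coeff_mul c d (qLocal_ne_zero M τ))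

lemma pow (hf : HasFourierExpansion M f c) (n : ℕ) :
    HasFourierExpansion M (fun τ => f τ ^ (n + 1)) (c ^ (n + 1)) := by
  induction n with
  | zero => simpa using hf
  | succ n ih => simpa only [pow_succ] using ih.mul hf

/-- Expansions are unique, by the identity theorem for the power series in `q_M`. -/
lemma eq_zero [NeZero M] (h : HasFourierExpansion M (fun _ => 0) c) : c = 0 := by
  obtain ⟨h1, h2⟩ := hasFPowerSeriesAt_of_laurent (n := c.order)
    (fun k hk => HahnSeries.coeff_eq_zero_of_lt_order hk) h.eventually_summable
  obtain ⟨Y, hY⟩ := h.hasSum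
  have h3 : ∀ᶠ q in nhdsWithin (0 : ℂ) {0}ᶜ, ∑' j : ℕ, q ^ j • c.coeff (c.order + j) = 0 := by
    filter_upwards [h2, eventually_exists_qLocal_eq M Y, self_mem_nhdsWithin] with q hq hτ hq0
    obtain ⟨τ, hτ, rfl⟩ := hτ
    rw [(hY τ hτ).tsum_eq] at hq
    exact (mul_eq_zero.mp hq.symm).resolve_left (zpow_ne_zero _ hq0)
  have h4 := (h1.analyticAt.frequently_zero_iff_eventually_zero).mp h3.frequently
  have h5 := (h1.congr (g := 0) h4).eq_zero
  have h6 := congrArg (fun p => FormalMultilinearSeries.coeff p 0) h5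
  simp only [FormalMultilinearSeries.coeff_ofScalars, Nat.cast_zero, add_zero] at h6
  rw [← HahnSeries.coeff_order_eq_zero, h6]
  simp [FormalMultilinearSeries.coeff]

lemma unique [NeZero M] (hc : HasFourierExpansion M f c) (hd : HasFourierExpansion M f d) :
    c = d := by
  have := hc.sub hd
  simp only [sub_self] at this
  exact sub_eq_zero.mp this.eq_zero

/-- The expansion of a quotient is the quotient of the expansions in the field of Laurent
series. -/
lemma div [NeZero M] (hf : HasFourierExpansion M f c) (hg : HasFourierExpansion M g d)
    (hg0 : ∀ τ, g τ ≠ 0) : HasFourierExpansion M (fun τ => f τ / g τ) (c / d) := by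
  obtain ⟨e, he⟩ := (hf.isMeroAtInfty.div hg.isMeroAtInfty).exists_hasFourierExpansion
  have h1 := he.mul hg
  simp only [div_mul_cancel₀ _ (hg0 _)] at h1
  have hd : d ≠ 0 := by
    rintro rfl
    obtain ⟨Y, hY⟩ := hg
    have hτ : Y < (⟨(max Y 0 + 1) * I, by simp; positivity⟩ : ℍ).im := by
      change Y < ((max Y 0 + 1 : ℂ) * I).im
      simp
      exact lt_of_le_of_lt (le_max_left Y 0) (lt_add_one _)
    have h2 := hY _ hτ
    simp only [HahnSeries.coeff_zero, zero_mul] at h2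
    exact hg0 _ (h2.unique hasSum_zero)
  rw [eq_div_of_mul_eq hd (h1.unique hf)] at he
  exact he

lemma congr (h : HasFourierExpansion M f c) (hfg : ∀ τ, f τ = g τ) :
    HasFourierExpansion M g c := by
  rwa [← funext hfg]

end HasFourierExpansion

/-! ### Series with sparse exponents -/

/-- The Laurent series `∑_n a_n X^{e(n)}`, for nonnegative exponents `e(n)`, each of which occurs
finitely often. -/
def sparseSeries {R : Type*} [AddCommMonoid R] (a : ℤ → R) (e : ℤ → ℤ) (he : ∀ n, 0 ≤ e n)
    (hfin : ∀ k, (e ⁻¹' {k}).Finite) : LaurentSeries R :=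
  HahnSeries.ofSuppBddBelow (fun k => ∑ n ∈ (hfin k).toFinset, a n) (by
    refine ⟨0, fun k hk => ?_⟩
    by_contra hlt
    refine hk (Finset.sum_eq_zero fun n hn => ?_)
    have h1 : e n = k := by simpa using hn
    exact absurd (he n) (by omega))

lemma sparseSeries_map {R S F : Type*} [AddCommMonoid R] [AddCommMonoid S] [FunLike F R S]
    [AddMonoidHomClass F R S] (φ : F) (a : ℤ → R) (e : ℤ → ℤ) (he : ∀ n, 0 ≤ e n)
    (hfin : ∀ k, (e ⁻¹' {k}).Finite) :
    HahnSeries.map (sparseSeries a e he hfin) φ = sparseSeries (fun n => φ (a n)) e he hfin := by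
  ext k
  rw [HahnSeries.map_coeff]
  exact map_sum φ a _

lemma hasFourierExpansion_sparseSeries {M : ℕ} {f : ℍ → ℂ} (a : ℤ → ℂ) (e : ℤ → ℤ)
    (he : ∀ n, 0 ≤ e n) (hfin : ∀ k, (e ⁻¹' {k}).Finite)
    (h : ∀ τ : ℍ, HasSum (fun n => a n * exp (2 * Real.pi * I * e n * τ / M)) (f τ)) :
    HasFourierExpansion M f (sparseSeries a e he hfin) := by
  refine ⟨0, fun τ _ => ?_⟩
  have h1 := (h τ).tsum_fiberwise e
  refine h1.congr_fun fun k => ?_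
  have : Fintype (e ⁻¹' {k}) := (hfin k).fintype
  rw [tsum_fintype, sparseSeries]
  change (∑ n ∈ (hfin k).toFinset, a n) * _ = _
  rw [Finset.sum_mul, Finset.sum_subtype (p := fun n => n ∈ e ⁻¹' {k}) (hfin k).toFinset (by simp)]
  refine Finset.sum_congr rfl fun n _ => ?_
  have : e n = k := n.2
  rw [this]

lemma finite_preimage_mul_sq {C A B : ℤ} (hC : 0 < C) (hA : 0 < A) (k : ℤ) :
    ((fun n : ℤ => C * (A * n + B) ^ 2) ⁻¹' {k}).Finite := by
  refine (Set.finite_Icc (-(|k| + |B|)) (|k| + |B|)).subset fun n hn => ?_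
  have hn' : C * (A * n + B) ^ 2 = k := hn
  have h1 : |A * n + B| ≤ |k| := by
    rw [← hn', abs_mul, abs_of_pos hC, abs_pow]
    have := abs_nonneg (A * n + B)
    rcases this.eq_or_lt with h | h
    · rw [← h]; simp
    · nlinarith
  have h2 : |n| ≤ |A * n| := by
    rw [abs_mul, abs_of_pos hA]
    nlinarith [abs_nonneg n]
  have h3 : |A * n| ≤ |A * n + B| + |B| := by
    simpa using abs_sub (A * n + B) B
  exact Set.mem_Icc.mpr (abs_le.mp (by linarith))

/-! ### Theta series of characters as combinations of Klein forms -/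

/-- The theta function of the residue class `r` modulo `N`, as a function of `τ = N z`. -/
def thetaRes (N ε : ℕ) (r : ℤ) (τ : ℂ) : ℂ := thetaCh ε (r / N) 0 τ

lemma charEps_le_one {N : ℕ} (χ : DirichletCharacter ℂ N) : charEps χ ≤ 1 := by
  unfold charEps; split_ifs <;> simp

/-- `thetaRes N ε r` depends on `r` modulo `N` only. -/
lemma thetaRes_congr {N : ℕ} [NeZero N] (ε : ℕ) {r s : ℤ} (h : (r : ZMod N) = s) (τ : ℂ) :
    thetaRes N ε r τ = thetaRes N ε s τ := by
  obtain ⟨k, hk⟩ := ((ZMod.intCast_eq_intCast_iff_dvd_sub r s N).mp h)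
  have hN : (N : ℂ) ≠ 0 := Nat.cast_ne_zero.mpr (NeZero.ne N)
  have : (s : ℂ) / N = r / N + k := by
    have h1 : (s : ℂ) = r + N * k := by
      have : s = r + N * k := by omega
      exact_mod_cast congrArg (Int.cast : ℤ → ℂ) this
    rw [h1]
    field_simp
  rw [thetaRes, thetaRes, this, thetaCh_add_intCast_left]

/-- The series `θ_χ(τ/N)`, sorted by the residue classes modulo `N`. -/
lemma hasSum_thetaChar {N : ℕ} [NeZero N] (χ : DirichletCharacter ℂ N) {τ : ℂ} (hτ : 0 < τ.im) :
    HasSum (fun n : ℤ => (n : ℂ) ^ charEps χ * χ (n : ZMod N) *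
        exp (Real.pi * I * (n : ℂ) ^ 2 * (τ / N) / N))
      ((N : ℂ) ^ charEps χ * ∑ r : ZMod N, χ r * thetaRes N (charEps χ) r.val τ) := by
  have hN : (N : ℂ) ≠ 0 := Nat.cast_ne_zero.mpr (NeZero.ne N)
  have hNZ : (N : ℤ) ≠ 0 := by exact_mod_cast NeZero.ne N
  set f : ℤ → ℂ := fun n => (n : ℂ) ^ charEps χ * χ (n : ZMod N) *
        exp (Real.pi * I * (n : ℂ) ^ 2 * (τ / N) / N) with hf
  -- the sum over a single residue class
  have key : ∀ r : ZMod N, HasSum (fun n : ℤ => if (n : ZMod N) = r then f n else 0)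
      ((N : ℂ) ^ charEps χ * (χ r * thetaRes N (charEps χ) r.val τ)) := by
    intro r
    have hinj : Function.Injective fun n : ℤ => (N : ℤ) * n + r.val := fun a b hab =>
      mul_left_cancel₀ hNZ (add_right_cancel hab)
    refine (hinj.hasSum_iff fun n hn => ?_).mp ?_
    · rw [if_neg]
      intro h
      have h1 : ((r.val : ℤ) : ZMod N) = (n : ZMod N) := by rw [h]; simp
      obtain ⟨k, hk⟩ := (ZMod.intCast_eq_intCast_iff_dvd_sub _ _ N).mp h1
      exact hn ⟨k, by simp only; omega⟩
    · have h1 := (hasSum_thetaCh (charEps_le_one χ) hτ ((r.val : ℤ) / N) 0).mul_left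
        ((N : ℂ) ^ charEps χ * χ r)
      rw [← mul_assoc]
      refine h1.congr_fun fun n => ?_
      have h2 : (((N : ℤ) * n + r.val : ℤ) : ZMod N) = r := by simp
      have h3 : (((N : ℤ) * n + r.val : ℤ) : ℂ) = N * (n + (r.val : ℤ) / N) := by
        push_cast; field_simp
      simp only [Function.comp, h2, if_true, hf, h3, mul_pow]
      have h4 : (Real.pi * I * ((N : ℂ) ^ 2 * (n + (r.val : ℤ) / N) ^ 2) * (τ / N) / N : ℂ) =
          Real.pi * I * (n + (r.val : ℤ) / N) ^ 2 * τ +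
            2 * Real.pi * I * (n + (r.val : ℤ) / N) * 0 := by
        field_simp; ring
      rw [h4]
      ring
  have h := hasSum_sum (s := Finset.univ) fun r _ => key r
  rw [← Finset.mul_sum] at h
  refine h.congr_fun fun n => ?_
  rw [Finset.sum_ite_eq]
  simp

lemma thetaChar_div_eq {N : ℕ} [NeZero N] (χ : DirichletCharacter ℂ N) {τ : ℂ} (hτ : 0 < τ.im) :
    thetaChar χ (τ / N) =
      (N : ℂ) ^ charEps χ * ∑ r : ZMod N, χ r * thetaRes N (charEps χ) r.val τ :=
  (hasSum_thetaChar χ hτ).tsum_eq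

/-- The characteristic `(r/N, 0)` is `(x + 1/2, y + 1/2)` with `x = r/N - 1/2` and `y = -1/2`. -/
lemma thetaRes_div_eta_eq (N ε : ℕ) (r : ℤ) (τ : ℂ) :
    thetaRes N ε r τ / ModularForm.eta τ ^ (1 + 2 * ε) =
      exp (Real.pi * I * ((r / N - 1 / 2) / 2)) * siegel ε (r / N - 1 / 2) (-1 / 2) τ := by
  rw [siegel, klein, thetaRes, mul_div_assoc', ← mul_assoc, ← Complex.exp_add]
  have h1 : (Real.pi * I * (((r : ℂ) / N - 1 / 2) / 2) +
      -(Real.pi * I * (((r : ℂ) / N - 1 / 2) * (-1 / 2) + ((r : ℂ) / N - 1 / 2)))) = 0 := by ring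
  rw [h1, Complex.exp_zero, one_mul]
  norm_num

/-- For `γ = (a, N²b₀; c, e)` with `a + c` and `b₀ + e` odd, the theta functions of the residue
classes are permuted by `γ`, up to a common factor. -/
theorem thetaRes_smul {N : ℕ} (hN : Odd N) {ε : ℕ} (hε : ε ≤ 1)
    (γ : Matrix.SpecialLinearGroup (Fin 2) ℤ) (b₀ : ℤ) (hb : γ 0 1 = N ^ 2 * b₀)
    (hac : Odd (γ 0 0 + γ 1 0)) (hbe : Odd (b₀ + γ 1 1)) (hbc : Even (b₀ * (1 - γ 1 0)))
    (r : ℤ) (τ : ℍ) :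
    thetaRes N ε r (γ • τ : ℍ) / ModularForm.eta (γ • τ : ℍ) ^ (1 + 2 * ε) =
      zetaM 12 ^ ((1 - ε) * ell γ) * exp (Real.pi * I * ((γ 1 1 * γ 1 0 + γ 0 0 * b₀ +
        2 * N * b₀ * (1 - γ 1 0) - 2 * γ 1 1 + 2 : ℤ) / 4)) *
      (thetaRes N ε (γ 0 0 * r) τ / ModularForm.eta τ ^ (1 + 2 * ε)) := by
  obtain ⟨h, hh⟩ := hN
  have hN0 : NeZero N := ⟨by omega⟩
  have hNC : (N : ℂ) ≠ 0 := Nat.cast_ne_zero.mpr (NeZero.ne N)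
  have hdet := det_eq γ
  -- `n` is the shift of the second coordinate of the characteristic that `γ` produces; replacing the
  -- representative `a r` by `a r + N w` makes the shift of the first coordinate vanish
  obtain ⟨w, hw⟩ : ∃ w, γ 0 0 + γ 1 0 + 2 * w = 1 := by
    obtain ⟨k, hk⟩ := hac; exact ⟨-k, by omega⟩
  obtain ⟨n, hn⟩ : ∃ n, 2 * n = 2 * N * b₀ * r - N ^ 2 * b₀ - γ 1 1 + 1 := by
    obtain ⟨k, hk⟩ := hbe
    refine ⟨N * b₀ * r - 2 * (h ^ 2 + h) * b₀ - k, ?_⟩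
    have : (N : ℤ) = 2 * h + 1 := by exact_mod_cast hh
    rw [this]
    linear_combination hk
  obtain ⟨u, hu⟩ := hbc
  obtain ⟨v, hv⟩ : Even ((r - h) * (r - h - 1)) := Int.even_mul_pred_self _
  rw [thetaRes_congr ε (r := γ 0 0 * r) (s := γ 0 0 * r + N * w) (by simp), thetaRes_div_eta_eq,
    thetaRes_div_eta_eq, siegel_smul hε]
  have hNh : (N : ℂ) = 2 * h + 1 := by exact_mod_cast congrArg (Nat.cast : ℕ → ℂ) hh
  have hwC : (γ 0 0 : ℂ) + γ 1 0 + 2 * w = 1 := by exact_mod_cast congrArg (Int.cast : ℤ → ℂ) hw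
  have hnC : 2 * (n : ℂ) = 2 * N * b₀ * r - N ^ 2 * b₀ - γ 1 1 + 1 := by
    exact_mod_cast congrArg (Int.cast : ℤ → ℂ) hn
  have hbC : (γ 0 1 : ℂ) = N ^ 2 * b₀ := by exact_mod_cast congrArg (Int.cast : ℤ → ℂ) hb
  have hdC : (γ 0 0 : ℂ) * γ 1 1 - γ 0 1 * γ 1 0 = 1 := by
    exact_mod_cast congrArg (Int.cast : ℤ → ℂ) hdet
  have huC : (b₀ : ℂ) * (1 - γ 1 0) = u + u := by exact_mod_cast congrArg (Int.cast : ℤ → ℂ) hu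
  have hvC : ((r : ℂ) - h) * (r - h - 1) = v + v := by
    exact_mod_cast congrArg (Int.cast : ℤ → ℂ) hv
  have hx : ((r : ℂ) / N - 1 / 2) * γ 0 0 + -1 / 2 * γ 1 0 =
      ((γ 0 0 * r + N * w : ℤ) : ℂ) / N - 1 / 2 + (0 : ℤ) := by
    push_cast
    field_simp
    linear_combination -(N : ℂ) * hwC
  have hy : ((r : ℂ) / N - 1 / 2) * γ 0 1 + -1 / 2 * γ 1 1 = -1 / 2 + n := by
    rw [hbC]
    field_simp
    linear_combination -hnC
  rw [hx, hy, siegel, klein_add_intCast, siegel]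
  -- the phases differ by an even multiple of `πi`, in view of the parity conditions
  have hphase : exp (Real.pi * I * (((r : ℂ) / N - 1 / 2) / 2)) *
      exp (Real.pi * I * ((0 : ℤ) + n + (0 : ℤ) * n +
        (n * (((γ 0 0 * r + N * w : ℤ) : ℂ) / N - 1 / 2) - (0 : ℤ) * (-1 / 2)))) =
      exp (Real.pi * I * ((γ 1 1 * γ 1 0 + γ 0 0 * b₀ +
        2 * N * b₀ * (1 - γ 1 0) - 2 * γ 1 1 + 2 : ℤ) / 4)) *
      exp (Real.pi * I * ((((γ 0 0 * r + N * w : ℤ) : ℂ) / N - 1 / 2) / 2)) := by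
    have h1 : exp (2 * Real.pi * I * (γ 0 0 * b₀ * v + N * u * (r - h - 1) : ℤ)) = 1 := by
      rw [mul_comm]; exact Complex.exp_int_mul_two_pi_mul_I _
    rw [← Complex.exp_add, ← Complex.exp_add]
    have hadd : ∀ z : ℂ, exp z = exp (z + 2 * Real.pi * I *
        (γ 0 0 * b₀ * v + N * u * (r - h - 1) : ℤ)) := fun z => by
      rw [Complex.exp_add, h1, mul_one]
    refine Eq.trans (congrArg exp ?_) (hadd _).symm
    have hn2 : (n : ℂ) = (2 * N * b₀ * r - N ^ 2 * b₀ - γ 1 1 + 1) / 2 := by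
      linear_combination hnC / 2
    have hw2 : (w : ℂ) = (1 - γ 0 0 - γ 1 0) / 2 := by linear_combination hwC / 2
    have hu2 : (u : ℂ) = b₀ * (1 - γ 1 0) / 2 := by linear_combination -huC / 2
    have hv2 : (v : ℂ) = (r - h) * (r - h - 1) / 2 := by linear_combination -hvC / 2
    have hr : (r : ℂ) / N - 1 / 2 = (2 * r - N) / (2 * N) := by field_simp
    push_cast
    rw [hbC] at hdC
    rw [hn2, hw2, hu2, hv2]
    have hhN : (h : ℂ) = (N - 1) / 2 := by rw [hNh]; ring
    rw [hhN]
    field_simp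
    linear_combination (4 * (N : ℂ) - 8 * r) * hdC
  linear_combination (zetaM 12 ^ ((1 - ε) * ell γ) *
    klein ε (((γ 0 0 * r + N * w : ℤ) : ℂ) / N - 1 / 2) (-1 / 2) τ /
      ModularForm.eta τ ^ (1 + 2 * ε)) * hphase

/-! ### The quotient of eta functions as a product of Siegel functions -/

/-- The sum of squares in the leading exponent of the product in `prod_siegel_eq`. -/
lemma sum_sq_half_sub (n : ℕ) {K : ℂ} (hK : K ≠ 0) :
    ∑ r ∈ Finset.range n, (1 / 2 - ((r : ℂ) + 1) / K) ^ 2 =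
      n / 4 - n * (n + 1) / (2 * K) + n * (n + 1) * (2 * n + 1) / (6 * K ^ 2) := by
  induction n with
  | zero => simp
  | succ n ih =>
    rw [Finset.sum_range_succ, ih]
    push_cast
    field_simp
    ring

/-- For odd `N = 2 h + 1`, the quotient `η(τ/N)/η(τ)` is up to a constant a product of Siegel
functions, by the triple product. -/
theorem prod_siegel_eq {τ : ℂ} (hτ : 0 < τ.im) (h : ℕ) :
    ∏ r ∈ Finset.range h, siegel 0 (-((r + 1 : ℂ) / (2 * h + 1))) 0 τ =
      I ^ h * (ModularForm.eta (τ / (2 * h + 1)) / ModularForm.eta τ) := by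
  have hN : (2 * h + 1 : ℂ) ≠ 0 := by exact_mod_cast Nat.succ_ne_zero (2 * h)
  have hE := eulerProd_ne_zero hτ
  have hJ := prod_jacobiTheta₂_mul_eulerProd hτ h
  have hs : ∀ r : ℕ, siegel 0 (-((r + 1 : ℂ) / (2 * h + 1))) 0 τ =
      (I * exp (-(Real.pi * I * τ / 12)) * (eulerProd τ)⁻¹) *
        exp (Real.pi * I * τ * (1 / 2 - ((r : ℂ) + 1) / (2 * h + 1)) ^ 2) *
        jacobiTheta₂ (-((r + 1 : ℂ) / (2 * h + 1)) * τ + τ / 2 + 1 / 2) τ := by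
    intro r
    have e1 : exp (-(Real.pi * I * (-((r + 1 : ℂ) / (2 * h + 1)) * 0 +
          -((r + 1 : ℂ) / (2 * h + 1))))) *
        exp (Real.pi * I * (-((r + 1 : ℂ) / (2 * h + 1)) + 1 / 2) ^ 2 * τ +
          2 * Real.pi * I * (-((r + 1 : ℂ) / (2 * h + 1)) + 1 / 2) * (0 + 1 / 2)) *
        exp (-(2 * Real.pi * I * τ / 24)) =
        I * exp (-(Real.pi * I * τ / 12)) *
          exp (Real.pi * I * τ * (1 / 2 - ((r : ℂ) + 1) / (2 * h + 1)) ^ 2) := by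
      rw [show I = exp (Real.pi / 2 * I) from Complex.exp_pi_div_two_mul_I.symm,
        ← Complex.exp_add, ← Complex.exp_add, ← Complex.exp_add, ← Complex.exp_add]
      rw [show exp (Real.pi / 2 * I) = I from Complex.exp_pi_div_two_mul_I]
      congr 1
      ring
    rw [siegel, klein, thetaCh_zero_eq hτ, eta_eq_exp_mul_eulerProd,
      show 1 + 2 * 0 = 1 from rfl, pow_one, show (-((r + 1 : ℂ) / (2 * h + 1)) + 1 / 2) * τ + (0 + 1 / 2) =
        -((r + 1 : ℂ) / (2 * h + 1)) * τ + τ / 2 + 1 / 2 by ring, div_eq_mul_inv, mul_inv,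
      ← Complex.exp_neg]
    linear_combination (jacobiTheta₂ (-((r + 1 : ℂ) / (2 * h + 1)) * τ + τ / 2 + 1 / 2) τ *
      (eulerProd τ)⁻¹) * e1
  simp_rw [hs, Finset.prod_mul_distrib, Finset.prod_const, Finset.card_range]
  rw [← Complex.exp_sum, ← Finset.mul_sum, sum_sq_half_sub h hN, eta_eq_exp_mul_eulerProd,
    eta_eq_exp_mul_eulerProd]
  have e2 : exp (-(Real.pi * I * τ / 12)) ^ h * exp (Real.pi * I * τ * (h / 4 -
      h * (h + 1) / (2 * (2 * h + 1)) + h * (h + 1) * (2 * h + 1) / (6 * (2 * h + 1) ^ 2))) *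
      exp (2 * Real.pi * I * τ / 24) = exp (2 * Real.pi * I * (τ / (2 * h + 1)) / 24) := by
    rw [← Complex.exp_nat_mul, ← Complex.exp_add, ← Complex.exp_add]
    congr 1
    have hh : (h : ℂ) = ((2 * h + 1) - 1) / 2 := by ring
    generalize (2 * h + 1 : ℂ) = K at *
    rw [hh]
    field_simp
    ring
  rw [← e2]
  have he := Complex.exp_ne_zero (2 * Real.pi * I * τ / 24)
  rw [eq_div_of_mul_eq hE hJ, inv_pow]
  generalize exp (-(Real.pi * I * τ / 12)) ^ h = A
  generalize eulerProd (τ / (2 * h + 1)) = B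
  generalize exp (2 * Real.pi * I * τ / 24) = C at *
  generalize exp (Real.pi * I * τ * _) = D
  field_simp

/-! ### Holomorphy and expansions of the building blocks -/

/-- The series for `jacobiTheta₂'` along the line `z ↦ (α z + β, z)` converges locally uniformly. -/
lemma differentiableAt_jacobiTheta₂'_comp (α β : ℂ) {τ : ℂ} (hτ : 0 < τ.im) :
    DifferentiableAt ℂ (fun z => jacobiTheta₂' (α * z + β) z) τ := by
  set S : ℝ := |(α * τ + β).im| + 1 with hS
  have hT : 0 < τ.im / 2 := by positivity
  let s : Set ℂ := {z | τ.im / 2 < z.im} ∩ {z | |(α * z + β).im| < S}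
  have hs : IsOpen s := (isOpen_lt continuous_const Complex.continuous_im).inter
    (isOpen_lt (Complex.continuous_im.comp (by fun_prop)).abs continuous_const)
  have hmem : τ ∈ s := ⟨by simp only [Set.mem_ofPred_eq]; linarith, by simp [hS]⟩
  have hu := (summable_pow_mul_jacobiTheta₂_term_bound S hT 1).mul_left (2 * Real.pi)
  refine DifferentiableOn.differentiableAt (s := s) ?_ (hs.mem_nhds hmem)
  refine differentiableOn_tsum_of_summable_norm hu (fun n => ?_) hs fun n z hz => ?_
  · unfold jacobiTheta₂'_term jacobiTheta₂_term
    fun_prop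
  · have := norm_jacobiTheta₂'_term_le hT hz.2.le hz.1.le n
    simpa [mul_assoc] using this

lemma differentiableAt_jacobiTheta₂_comp (α β : ℂ) {τ : ℂ} (hτ : 0 < τ.im) :
    DifferentiableAt ℂ (fun z => jacobiTheta₂ (α * z + β) z) τ := by
  have h1 := (hasFDerivAt_jacobiTheta₂ (α * τ + β) hτ).differentiableAt
  have h2 : DifferentiableAt ℂ (fun z : ℂ => (α * z + β, z)) τ := by fun_prop
  exact DifferentiableAt.comp τ (f := fun z : ℂ => (α * z + β, z)) h1 h2

lemma differentiableAt_thetaCh {ε : ℕ} (hε : ε ≤ 1) (α β : ℂ) {τ : ℂ} (hτ : 0 < τ.im) :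
    DifferentiableAt ℂ (thetaCh ε α β) τ := by
  have hopen : ∀ᶠ z in nhds τ, 0 < z.im :=
    (isOpen_lt continuous_const Complex.continuous_im).mem_nhds hτ
  have h1 := differentiableAt_jacobiTheta₂_comp α β hτ
  have h2 := differentiableAt_jacobiTheta₂'_comp α β hτ
  interval_cases ε
  · have : DifferentiableAt ℂ (fun z => exp (Real.pi * I * α ^ 2 * z + 2 * Real.pi * I * α * β) *
        jacobiTheta₂ (α * z + β) z) τ := by fun_prop
    exact this.congr_of_eventuallyEq (hopen.mono fun z hz => thetaCh_zero_eq hz α β)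
  · have : DifferentiableAt ℂ (fun z => exp (Real.pi * I * α ^ 2 * z + 2 * Real.pi * I * α * β) *
        (jacobiTheta₂' (α * z + β) z / (2 * Real.pi * I) + α * jacobiTheta₂ (α * z + β) z)) τ := by
      fun_prop
    exact this.congr_of_eventuallyEq (hopen.mono fun z hz => thetaCh_one_eq hz α β)

lemma div_natCast_im_pos {N : ℕ} [NeZero N] {τ : ℂ} (hτ : 0 < τ.im) : 0 < (τ / N).im := by
  have : (0 : ℝ) < N := by exact_mod_cast NeZero.pos N
  rw [Complex.div_natCast_im]
  positivity

/-- `η` as a theta series: the case `N = 3` of the product formula, which is Euler's pentagonal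
number theorem. -/
theorem hasSum_eta {z : ℂ} (hz : 0 < z.im) :
    HasSum (fun n : ℤ => (-1) ^ n * exp (2 * Real.pi * I * (6 * n + 1) ^ 2 * z / 24))
      (ModularForm.eta z) := by
  have hz3 : 0 < (3 * z).im := by simp [hz]
  have h := prod_jacobiTheta₂_mul_eulerProd hz3 1
  simp only [Finset.range_one, Finset.prod_singleton, Nat.cast_zero, Nat.cast_one, pow_one] at h
  have h2 : jacobiTheta₂ (z / 2 + 1 / 2) (3 * z) = eulerProd z := by
    refine mul_right_cancel₀ (eulerProd_ne_zero hz3) ?_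
    rw [show z / 2 + 1 / 2 = -((0 + 1 : ℂ) / (2 * 1 + 1)) * (3 * z) + 3 * z / 2 + 1 / 2 by ring, h,
      mul_comm]
    congr 2
    ring
  have h3 := (hasSum_jacobiTheta₂_term (z / 2 + 1 / 2) hz3).mul_left
    (exp (2 * Real.pi * I * z / 24))
  rw [h2, ← eta_eq_exp_mul_eulerProd] at h3
  refine h3.congr_fun fun n => ?_
  rw [← Complex.exp_pi_mul_I, ← Complex.exp_int_mul, jacobiTheta₂_term, ← Complex.exp_add,
    ← Complex.exp_add]
  congr 1
  ring

section Level

variable {N m : ℕ} [NeZero N] [NeZero m]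

lemma level_ne_zero : ((24 * m * N ^ 2 : ℕ) : ℂ) ≠ 0 := by
  have := NeZero.ne N
  have := NeZero.ne m
  exact_mod_cast (by positivity : 24 * m * N ^ 2 ≠ 0)

lemma isMeroAtInfty_eta : IsMeroAtInfty (24 * m * N ^ 2) fun τ => ModularForm.eta τ := by
  have hm : (0 : ℤ) < m * N ^ 2 := by
    have := NeZero.pos N
    have := NeZero.pos m
    positivity
  have : NeZero (24 * m * N ^ 2) := ⟨by exact_mod_cast level_ne_zero (N := N) (m := m)⟩
  refine (hasFourierExpansion_sparseSeries (fun n => (-1) ^ n)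
    (fun n => (m * N ^ 2 : ℤ) * (6 * n + 1) ^ 2) (fun n => by positivity)
    (finite_preimage_mul_sq hm (by norm_num)) fun τ => ?_).isMeroAtInfty
  refine (hasSum_eta τ.im_pos).congr_fun fun n => ?_
  have hmC : (m : ℂ) ≠ 0 := Nat.cast_ne_zero.mpr (NeZero.ne m)
  have hNC : (N : ℂ) ≠ 0 := Nat.cast_ne_zero.mpr (NeZero.ne N)
  push_cast
  congr 2
  field_simp

/-- At level `24 m N²` the exponents `(n + j/(2N) + 1/2)²/2` and `1/24` are integral multiples of
`1/(24 m N²)`. -/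
lemma isMeroAtInfty_siegel {ε : ℕ} (hε : ε ≤ 1) (j : ℤ) (y : ℂ) :
    IsMeroAtInfty (24 * m * N ^ 2) fun τ => siegel ε (j / (2 * N)) y τ := by
  have hm : (0 : ℤ) < 3 * m := by
    have := NeZero.pos m
    positivity
  have hN : (0 : ℤ) < 2 * N := by
    have := NeZero.pos N
    positivity
  have hNC : (N : ℂ) ≠ 0 := Nat.cast_ne_zero.mpr (NeZero.ne N)
  have : NeZero (24 * m * N ^ 2) := ⟨by exact_mod_cast level_ne_zero (N := N) (m := m)⟩
  refine IsMeroAtInfty.div ((IsMeroAtInfty.const _ _).mul ?_) (isMeroAtInfty_eta.pow _)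
  refine (hasFourierExpansion_sparseSeries
    (fun n => (n + ((j : ℂ) / (2 * N) + 1 / 2)) ^ ε *
      exp (2 * Real.pi * I * (n + ((j : ℂ) / (2 * N) + 1 / 2)) * (y + 1 / 2)))
    (fun n => (3 * m : ℤ) * ((2 * N : ℤ) * n + (j + N)) ^ 2) (fun n => by positivity)
    (finite_preimage_mul_sq hm hN) fun τ => ?_).isMeroAtInfty
  refine (hasSum_thetaCh hε τ.im_pos _ _).congr_fun fun n => ?_
  rw [mul_assoc, ← Complex.exp_add]
  have hmC : (m : ℂ) ≠ 0 := Nat.cast_ne_zero.mpr (NeZero.ne m)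
  push_cast
  congr 2
  field_simp
  ring

end Level

/-! ### The functions `A_ψ` -/

/-- The numerator of `A_ψ`, normalized to weight zero by `η(τ)`. -/
def thetaQuot {N : ℕ} [NeZero N] (ψ : DirichletCharacter ℂ N) (τ : ℂ) : ℂ :=
  ∑ r : ZMod N, ψ r * (thetaRes N (charEps ψ) r.val τ / ModularForm.eta τ ^ (1 + 2 * charEps ψ))

/-- The product of Siegel functions that represents `η(τ/N) / η(τ)` for odd `N`. -/
def siegelProd (N : ℕ) (τ : ℂ) : ℂ :=
  ∏ r ∈ Finset.range (N / 2), siegel 0 (((-2 * (r + 1) : ℤ) : ℂ) / (2 * N)) 0 τ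

lemma siegelProd_eq {N : ℕ} (hN : Odd N) {τ : ℂ} (hτ : 0 < τ.im) :
    siegelProd N τ = I ^ (N / 2) * (ModularForm.eta (τ / N) / ModularForm.eta τ) := by
  obtain ⟨h, rfl⟩ := hN
  have h1 : (2 * h + 1) / 2 = h := by omega
  have h2 := prod_siegel_eq hτ h
  rw [siegelProd, h1]
  push_cast
  rw [← h2]
  refine Finset.prod_congr rfl fun r _ => ?_
  congr 1
  have hN : (2 * h + 1 : ℂ) ≠ 0 := by exact_mod_cast Nat.succ_ne_zero (2 * h)
  field_simp

/-- `A_ψ` as the weight zero numerator times a power of the weight zero quotient `η(τ)/η(τ/N)`. -/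
lemma funA_eq_eta {N : ℕ} [NeZero N] (ψ : DirichletCharacter ℂ N) (τ : ℍ) :
    funA ψ τ = (N : ℂ) ^ charEps ψ * thetaQuot ψ τ *
      (ModularForm.eta τ / ModularForm.eta ((τ : ℂ) / N)) ^ (1 + 2 * charEps ψ) := by
  have h0 := ModularForm.eta_ne_zero τ.im_pos
  rw [funA, thetaChar_div_eq ψ τ.im_pos, thetaQuot, div_pow]
  simp_rw [mul_div_assoc']
  rw [← Finset.sum_div]
  field_simp

/-- `A_ψ` in terms of the functions `siegel`, on which all of `SL₂(ℤ)` acts. -/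
lemma funA_eq {N : ℕ} [NeZero N] (hN : Odd N) (ψ : DirichletCharacter ℂ N) (τ : ℍ) :
    funA ψ τ = (N : ℂ) ^ charEps ψ * thetaQuot ψ τ *
      (I ^ (N / 2) / siegelProd N τ) ^ (1 + 2 * charEps ψ) := by
  have hI : I ^ (N / 2) ≠ 0 := pow_ne_zero _ Complex.I_ne_zero
  rw [funA_eq_eta, siegelProd_eq hN τ.im_pos]
  congr 2
  field_simp

lemma thetaQuot_eq_siegel {N : ℕ} [NeZero N] (ψ : DirichletCharacter ℂ N) (τ : ℂ) :
    thetaQuot ψ τ = ∑ r : ZMod N, ψ r * (exp (Real.pi * I * (((r.val : ℤ) / N - 1 / 2) / 2)) *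
      siegel (charEps ψ) ((r.val : ℤ) / N - 1 / 2) (-1 / 2) τ) := by
  simp_rw [thetaQuot, thetaRes_div_eta_eq]

/-- `A_ψ` is meromorphic at every cusp: `γ` permutes the functions `siegel` with characteristics in
`(1/(2N)) ℤ²`, up to constants, and each of them is meromorphic at `i∞`. -/
theorem isMeroAtInfty_funA_smul {N m : ℕ} [NeZero N] [NeZero m] (hN : Odd N)
    (ψ : DirichletCharacter ℂ N) (γ : Matrix.SpecialLinearGroup (Fin 2) ℤ) :
    IsMeroAtInfty (24 * m * N ^ 2) fun τ => funA ψ (γ • τ) := by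
  have hNC : (N : ℂ) ≠ 0 := Nat.cast_ne_zero.mpr (NeZero.ne N)
  simp only [funA_eq hN, thetaQuot_eq_siegel, siegelProd, siegel_smul (charEps_le_one ψ),
    siegel_smul (Nat.zero_le 1)]
  refine ((IsMeroAtInfty.const _ _).mul (IsMeroAtInfty.sum fun r _ => (IsMeroAtInfty.const _ _).mul
    ((IsMeroAtInfty.const _ _).mul ((IsMeroAtInfty.const _ _).mul ?_)))).mul
    (((IsMeroAtInfty.const _ _).div (IsMeroAtInfty.prod fun r _ =>
      (IsMeroAtInfty.const _ _).mul ?_)).pow _)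
  · have e : ((r.val : ℤ) / N - 1 / 2 : ℂ) * γ 0 0 + -1 / 2 * γ 1 0 =
        (((2 * r.val - N) * γ 0 0 - N * γ 1 0 : ℤ) : ℂ) / (2 * N) := by
      push_cast
      field_simp
      ring
    rw [e]
    exact isMeroAtInfty_siegel (charEps_le_one ψ) _ _
  · have e : ((-2 * (r + 1) : ℤ) : ℂ) / (2 * N) * γ 0 0 + 0 * γ 1 0 =
        ((-2 * (r + 1) * γ 0 0 : ℤ) : ℂ) / (2 * N) := by
      push_cast
      ring
    rw [e]
    exact isMeroAtInfty_siegel (Nat.zero_le 1) _ _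

/-- `A_ψ` is holomorphic, since `η` has no zeros. -/
lemma differentiableOn_funA {N : ℕ} [NeZero N] (ψ : DirichletCharacter ℂ N) :
    DifferentiableOn ℂ (fun z : ℂ => funA ψ (ofComplex z)) {z : ℂ | 0 < z.im} := by
  have hd : DifferentiableOn ℂ (fun z : ℂ => ((N : ℂ) ^ charEps ψ *
      ∑ r : ZMod N, ψ r * thetaRes N (charEps ψ) r.val z) /
      ModularForm.eta (z / N) ^ (1 + 2 * charEps ψ)) {z : ℂ | 0 < z.im} := by
    intro z hz
    have hz' : 0 < (z / N).im := div_natCast_im_pos hz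
    have h1 : DifferentiableAt ℂ (fun z : ℂ => ModularForm.eta (z / N)) z :=
      DifferentiableAt.comp z (f := fun z : ℂ => z / N)
        (ModularForm.differentiableAt_eta_of_mem_upperHalfPlaneSet hz') (by fun_prop)
    refine DifferentiableAt.differentiableWithinAt ?_
    refine DifferentiableAt.div ?_ (h1.pow _) (pow_ne_zero _ (ModularForm.eta_ne_zero hz'))
    refine DifferentiableAt.const_mul (DifferentiableAt.fun_sum fun r _ => ?_) _
    exact (differentiableAt_thetaCh (charEps_le_one ψ) _ _ hz).const_mul _
  refine hd.congr fun z hz => ?_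
  rw [funA, ofComplex_apply_of_im_pos hz, ← thetaChar_div_eq ψ hz]

/-! ### Invariance under the principal congruence subgroup -/

/-- As `γ` maps the theta function of the class `r` to that of `a r`, it multiplies their sum against
`ψ` by `ψ(a)⁻¹`. -/
lemma thetaQuot_smul {N : ℕ} [NeZero N] (hN : Odd N) (ψ : DirichletCharacter ℂ N)
    (γ : Matrix.SpecialLinearGroup (Fin 2) ℤ) (b₀ : ℤ) (hb : γ 0 1 = N ^ 2 * b₀)
    (hac : Odd (γ 0 0 + γ 1 0)) (hbe : Odd (b₀ + γ 1 1)) (hbc : Even (b₀ * (1 - γ 1 0)))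
    (τ : ℍ) :
    ψ (γ 0 0 : ZMod N) * thetaQuot ψ (γ • τ : ℍ) =
      zetaM 12 ^ ((1 - charEps ψ) * ell γ) * exp (Real.pi * I * ((γ 1 1 * γ 1 0 + γ 0 0 * b₀ +
        2 * N * b₀ * (1 - γ 1 0) - 2 * γ 1 1 + 2 : ℤ) / 4)) * thetaQuot ψ τ := by
  have hu : (γ 0 0 : ZMod N) * (γ 1 1 : ZMod N) = 1 := by
    have h := congrArg (Int.cast : ℤ → ZMod N) (det_eq γ)
    rw [hb] at h
    simpa using h
  let u : (ZMod N)ˣ := ⟨γ 0 0, γ 1 1, hu, by rw [mul_comm]; exact hu⟩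
  rw [thetaQuot, thetaQuot, Finset.mul_sum, Finset.mul_sum]
  refine Fintype.sum_equiv u.mulLeft _ _ fun r => ?_
  rw [thetaRes_smul hN (charEps_le_one ψ) γ b₀ hb hac hbe hbc, Units.mulLeft_apply, map_mul,
    thetaRes_congr (charEps ψ) (r := γ 0 0 * (r.val : ℤ)) (s := ((↑u * r : ZMod N).val : ℤ)) (by
      push_cast
      rw [ZMod.natCast_zmod_val, ZMod.natCast_zmod_val])]
  change _ = _ * (ψ (γ 0 0 : ZMod N) * ψ r * _)
  ring

lemma ell_modEq_zero {γ : Matrix.SpecialLinearGroup (Fin 2) ℤ}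
    (hγ : γ ∈ CongruenceSubgroup.Gamma 12) : ell γ ≡ 0 [ZMOD 12] := by
  obtain ⟨h1, h2, h3, h4⟩ := CongruenceSubgroup.Gamma_mem.mp hγ
  refine (ZMod.intCast_eq_intCast_iff _ _ 12).mp ?_
  simp only [ell]
  push_cast
  rw [h1, h2, h3, h4]
  ring

/-- The parts `a'`, `b'`, `c'`, `e'` of an element `1 + M (a', b'; c', e')` of `Γ(M)`. -/
lemma exists_of_mem_Gamma {M : ℕ} {γ : Matrix.SpecialLinearGroup (Fin 2) ℤ}
    (hγ : γ ∈ CongruenceSubgroup.Gamma M) : ∃ a b c e : ℤ, γ 0 0 = 1 + M * a ∧ γ 0 1 = M * b ∧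
      γ 1 0 = M * c ∧ γ 1 1 = 1 + M * e := by
  obtain ⟨h1, h2, h3, h4⟩ := CongruenceSubgroup.Gamma_mem.mp hγ
  have key : ∀ x y : ℤ, (x : ZMod M) = y → ∃ k : ℤ, x = y + M * k := fun x y h => by
    obtain ⟨k, hk⟩ := (ZMod.intCast_eq_intCast_iff_dvd_sub _ _ _).mp h.symm
    exact ⟨k, by omega⟩
  obtain ⟨a, ha⟩ := key _ 1 (by simpa using h1)
  obtain ⟨b, hb⟩ := key _ 0 (by simpa using h2)
  obtain ⟨c, hc⟩ := key _ 0 (by simpa using h3)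
  obtain ⟨e, he⟩ := key _ 1 (by simpa using h4)
  exact ⟨a, b, c, e, ha, by simpa using hb, by simpa using hc, he⟩

lemma ell_modEq_zero_of_level {N m : ℕ} {γ : Matrix.SpecialLinearGroup (Fin 2) ℤ}
    (hγ : γ ∈ CongruenceSubgroup.Gamma (24 * m * N ^ 2)) :
    ell γ ≡ 0 [ZMOD 12] := by
  obtain ⟨a, b, c, e, ha, hb, hc, he⟩ := exists_of_mem_Gamma hγ
  have h24 : (24 : ZMod 12) = 0 := by decide
  refine ell_modEq_zero (CongruenceSubgroup.Gamma_mem.mpr ?_)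
  rw [ha, hb, hc, he]
  push_cast
  simp [h24]

section Invariance

variable {N m : ℕ} [NeZero N] {γ : Matrix.SpecialLinearGroup (Fin 2) ℤ}

/-- Under `Γ(24 m N²)` the characteristics `(j/N, 0)` are shifted by multiples of `24 m N`, which
leaves the Klein forms unchanged. -/
lemma siegelProd_invariant (hγ : γ ∈ CongruenceSubgroup.Gamma (24 * m * N ^ 2)) (τ : ℍ) :
    siegelProd N (γ • τ : ℍ) = siegelProd N τ := by
  have hN : (N : ℂ) ≠ 0 := Nat.cast_ne_zero.mpr (NeZero.ne N)
  have hl : zetaM 12 ^ ((1 - (0 : ℕ)) * ell γ : ℤ) = 1 := by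
    rw [zetaM_zpow_congr (l := 0), zpow_zero]
    simpa using ell_modEq_zero_of_level hγ
  obtain ⟨a, b, c, e, ha, hb, hc, he⟩ := exists_of_mem_Gamma hγ
  refine Finset.prod_congr rfl fun r _ => ?_
  rw [siegel_smul (Nat.zero_le 1), hl, one_mul, ha, hb]
  have hx : ((-2 * (r + 1) : ℤ) : ℂ) / (2 * N) * (1 + (24 * m * N ^ 2 : ℕ) * a : ℤ) +
      0 * γ 1 0 = ((-2 * (r + 1) : ℤ) : ℂ) / (2 * N) + (-24 * (r + 1) * m * N * a : ℤ) := by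
    push_cast
    field_simp
    ring
  have hy : ((-2 * (r + 1) : ℤ) : ℂ) / (2 * N) * ((24 * m * N ^ 2 : ℕ) * b : ℤ) +
      0 * γ 1 1 = 0 + (-24 * (r + 1) * m * N * b : ℤ) := by
    push_cast
    field_simp
    ring
  rw [hx, hy, siegel, klein_add_intCast, siegel]
  have hp : exp (Real.pi * I * ((-24 * (r + 1) * m * N * a : ℤ) + (-24 * (r + 1) * m * N * b : ℤ) +
      (-24 * (r + 1) * m * N * a : ℤ) * (-24 * (r + 1) * m * N * b : ℤ) +
      ((-24 * (r + 1) * m * N * b : ℤ) * (((-2 * (r + 1) : ℤ) : ℂ) / (2 * N)) -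
        (-24 * (r + 1) * m * N * a : ℤ) * 0))) = 1 := by
    rw [Complex.exp_eq_one_iff]
    refine ⟨-12 * (r + 1) * m * N * (a + b) + 288 * ((r + 1) * m * N) ^ 2 * a * b +
      12 * (r + 1) ^ 2 * m * b, ?_⟩
    push_cast
    field_simp
    ring
  rw [hp, one_mul]

lemma thetaQuot_invariant (hN : Odd N) (ψ : DirichletCharacter ℂ N)
    (hγ : γ ∈ CongruenceSubgroup.Gamma (24 * m * N ^ 2)) (τ : ℍ) :
    thetaQuot ψ (γ • τ : ℍ) = thetaQuot ψ τ := by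
  obtain ⟨a, b, c, e, ha, hb, hc, he⟩ := exists_of_mem_Gamma hγ
  have h := thetaQuot_smul hN ψ γ (24 * m * b) (by rw [hb]; push_cast; ring)
    ⟨12 * m * N ^ 2 * (a + c), by rw [ha, hc]; push_cast; ring⟩
    ⟨12 * m * b + 12 * m * N ^ 2 * e, by rw [he]; push_cast; ring⟩
    ⟨12 * m * b * (1 - γ 1 0), by ring⟩ τ
  have h1 : (γ 0 0 : ZMod N) = 1 := by rw [ha]; push_cast; simp
  have hl : zetaM 12 ^ ((1 - charEps ψ) * ell γ : ℤ) = 1 := by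
    rw [zetaM_zpow_congr (l := 0), zpow_zero]
    simpa using (ell_modEq_zero_of_level hγ).mul_left (1 - charEps ψ : ℤ)
  rw [h1, hl, map_one, one_mul, one_mul] at h
  rw [h, Complex.exp_eq_one_iff.mpr, one_mul]
  refine ⟨3 * m * (N ^ 2 * c * γ 1 1 + γ 0 0 * b + 2 * N * b * (1 - γ 1 0) - 2 * N ^ 2 * e), ?_⟩
  rw [hc, he]
  push_cast
  ring

theorem funA_invariant (hN : Odd N) (ψ : DirichletCharacter ℂ N)
    (hγ : γ ∈ CongruenceSubgroup.Gamma (24 * m * N ^ 2)) (τ : ℍ) :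
    funA ψ (γ • τ) = funA ψ τ := by
  rw [funA_eq hN, funA_eq hN, thetaQuot_invariant hN ψ hγ, siegelProd_invariant hγ]

end Invariance

/-! ### The multiplier -/

/-- `η(τ)² / η(τ/N)²` under a matrix `(a, N²b₀; c, e)`: the conjugate matrix `(a, N b₀; N c, e)`
acts on `τ/N`. -/
lemma etaQuot_sq_smul {N : ℕ} [NeZero N] (γ γ' : Matrix.SpecialLinearGroup (Fin 2) ℤ) (b₀ : ℤ)
    (hb : γ 0 1 = N ^ 2 * b₀) (h00 : γ' 0 0 = γ 0 0) (h01 : γ' 0 1 = N * b₀)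
    (h10 : γ' 1 0 = N * γ 1 0) (h11 : γ' 1 1 = γ 1 1) (τ : ℍ) :
    (ModularForm.eta (γ • τ : ℍ) / ModularForm.eta ((γ • τ : ℍ) / N)) ^ 2 =
      zetaM 12 ^ (ell γ - ell γ') * (ModularForm.eta τ / ModularForm.eta (τ / N)) ^ 2 := by
  have hN : (N : ℂ) ≠ 0 := Nat.cast_ne_zero.mpr (NeZero.ne N)
  let σ : ℍ := ⟨(τ : ℂ) / N, div_natCast_im_pos τ.im_pos⟩
  have hσ : (σ : ℂ) = τ / N := rfl
  have h1 : ((γ • τ : ℍ) : ℂ) / N = (γ' • σ : ℍ) := by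
    have := denom_ne_zero' γ τ
    rw [coe_smul_eq, coe_smul_eq, h00, h01, h10, h11, hb, hσ]
    push_cast
    field_simp
  rw [h1, div_pow, eta_sq_smul, eta_sq_smul, h10, h11, hσ, zpow_sub₀ (zetaM_ne_zero 12)]
  have h2 : ((N * γ 1 0 : ℤ) : ℂ) * (τ / N) + γ 1 1 = γ 1 0 * τ + γ 1 1 := by
    push_cast
    field_simp
  have h3 := denom_ne_zero' γ τ
  have h4 := ModularForm.eta_ne_zero (div_natCast_im_pos (N := N) τ.im_pos)
  have h5 := zpow_ne_zero (ell γ') (zetaM_ne_zero 12)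
  rw [h2, div_pow]
  field_simp

/-- The multiplier of `A_ψ A_φ` for two characters of the same parity. The choice `φ = ψ` gives
the square of `A_ψ`, the choice `φ = ψ⁻¹` gives `B_ψ`. -/
theorem funA_mul_funA_smul {N : ℕ} [NeZero N] (hN : Odd N) (ψ φ : DirichletCharacter ℂ N)
    (hε : charEps φ = charEps ψ) (γ γ' : Matrix.SpecialLinearGroup (Fin 2) ℤ) (b₀ : ℤ)
    (hb : γ 0 1 = N ^ 2 * b₀) (hac : Odd (γ 0 0 + γ 1 0)) (hbe : Odd (b₀ + γ 1 1))
    (hbc : Even (b₀ * (1 - γ 1 0))) (h00 : γ' 0 0 = γ 0 0) (h01 : γ' 0 1 = N * b₀)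
    (h10 : γ' 1 0 = N * γ 1 0) (h11 : γ' 1 1 = γ 1 1) (τ : ℍ) :
    ψ (γ 0 0 : ZMod N) * φ (γ 0 0 : ZMod N) * (funA ψ (γ • τ) * funA φ (γ • τ)) =
      zetaM 12 ^ (3 * ell γ - (1 + 2 * charEps ψ) * ell γ' + 3 * (γ 1 1 * γ 1 0 + γ 0 0 * b₀ +
        2 * N * b₀ * (1 - γ 1 0) - 2 * γ 1 1 + 2)) * (funA ψ τ * funA φ τ) := by
  have h1 := thetaQuot_smul hN ψ γ b₀ hb hac hbe hbc τ
  have h2 := thetaQuot_smul hN φ γ b₀ hb hac hbe hbc τ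
  have h3 := etaQuot_sq_smul γ γ' b₀ hb h00 h01 h10 h11 τ
  rw [hε] at h2
  rw [funA_eq_eta ψ, funA_eq_eta φ, funA_eq_eta ψ, funA_eq_eta φ, hε]
  generalize (γ 1 1 * γ 1 0 + γ 0 0 * b₀ + 2 * N * b₀ * (1 - γ 1 0) - 2 * γ 1 1 + 2) = E at *
  have h4 : exp (Real.pi * I * (E / 4)) ^ 2 = zetaM 12 ^ (3 * E) := by
    rw [zetaM_twelve_zpow, ← Complex.exp_nat_mul]
    congr 1
    push_cast
    ring
  set R := ModularForm.eta (γ • τ : ℍ) / ModularForm.eta ((γ • τ : ℍ) / N)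
  set R' := ModularForm.eta τ / ModularForm.eta (τ / N)
  set ε := charEps ψ
  have h5 : (3 * ell γ - (1 + 2 * ε) * ell γ' + 3 * E : ℤ) =
      (1 - ε) * ell γ + ((1 - ε) * ell γ + (3 * E + (ell γ - ell γ') * (1 + 2 * ε : ℕ))) := by
    push_cast; ring
  rw [h5, zpow_add₀ (zetaM_ne_zero 12), zpow_add₀ (zetaM_ne_zero 12),
    zpow_add₀ (zetaM_ne_zero 12), zpow_mul _ _ ((1 + 2 * ε : ℕ) : ℤ), zpow_natCast, ← h4]
  calc _ = ((N : ℂ) ^ ε) ^ 2 * (ψ (γ 0 0 : ZMod N) * thetaQuot ψ (γ • τ : ℍ)) *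
        (φ (γ 0 0 : ZMod N) * thetaQuot φ (γ • τ : ℍ)) * (R ^ 2) ^ (1 + 2 * ε) := by ring
    _ = _ := by rw [h1, h2, h3]; ring

/-- The exponent of the multiplier of `A_ψ A_φ` for the lift `γ = (a, N²b₀; c, e)` of the `SL₂`-part
of a Cartan matrix of determinant `d`; there `a ≡ d e` and `b₀ ≡ - d c`. Both sides are polynomials,
so that the congruence can be verified over all residues modulo `3` and modulo `4` that satisfy
`det γ = 1`. -/
lemma cartan_exponent {N k ε d c e b₀ a t : ℤ} (hN : N = 2 * k + 1) (hε : ε = 0 ∨ ε = 1)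
    (γ γ' : Matrix.SpecialLinearGroup (Fin 2) ℤ)
    (ha : a ≡ d * e [ZMOD 12]) (hb : b₀ ≡ -(d * c) [ZMOD 12]) (ht : t ≡ a [ZMOD 12])
    (h00 : γ 0 0 = a) (h01 : γ 0 1 = N ^ 2 * b₀) (h10 : γ 1 0 = c) (h11 : γ 1 1 = e)
    (h00' : γ' 0 0 = a) (h01' : γ' 0 1 = N * b₀) (h10' : γ' 1 0 = N * c) (h11' : γ' 1 1 = e) :
    3 * ell γ - (1 + 2 * ε) * ell γ' + 3 * (e * c + a * b₀ + 2 * N * b₀ * (1 - c) - 2 * e + 2) ≡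
      6 * ((k + ε) * (t - 1)) [ZMOD 12] := by
  have hdet := det_eq γ
  rw [h00, h01, h10, h11] at hdet
  simp only [ell, h00, h01, h10, h11, h00', h01', h10', h11']
  subst hN
  have cast : ∀ p : ℕ, (p : ℤ) ∣ 12 → ∀ {x y : ℤ}, x ≡ y [ZMOD 12] → (x : ZMod p) = y :=
    fun p hp x y h => (ZMod.intCast_eq_intCast_iff _ _ p).mpr (h.of_dvd hp)
  refine modEq_twelve_of_zmod ?_ ?_
  · have ha := cast 3 (by norm_num) ha
    have hb := cast 3 (by norm_num) hb
    have ht := cast 3 (by norm_num) ht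
    have hdet := congrArg (Int.cast : ℤ → ZMod 3) hdet
    push_cast at ha hb ht hdet ⊢
    rw [ha] at ht
    rw [ha, hb] at hdet
    rw [ht, ha, hb]
    generalize (c : ZMod 3) = c at *
    generalize (e : ZMod 3) = e at *
    generalize (d : ZMod 3) = d at *
    generalize (k : ZMod 3) = k at *
    clear ha hb ht cast
    rcases hε with rfl | rfl
    · push_cast
      revert c e d k
      decide
    · push_cast
      revert c e d k
      decide
  · have ha := cast 4 (by norm_num) ha
    have hb := cast 4 (by norm_num) hb
    have ht := cast 4 (by norm_num) ht
    have hdet := congrArg (Int.cast : ℤ → ZMod 4) hdet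
    push_cast at ha hb ht hdet ⊢
    rw [ha] at ht
    rw [ha, hb] at hdet
    rw [ht, ha, hb]
    generalize (c : ZMod 4) = c at *
    generalize (e : ZMod 4) = e at *
    generalize (d : ZMod 4) = d at *
    generalize (k : ZMod 4) = k at *
    clear ha hb ht cast
    rcases hε with rfl | rfl
    · push_cast
      revert c e d k
      decide
    · push_cast
      revert c e d k
      decide

/-! ### Reduction of `SL₂(ℤ)` modulo `M` -/

/-- If `e ≠ 0` and no prime divides all of `c`, `e`, `M`, some `c + k M` is prime to `e`. -/
lemma exists_isCoprime_add_mul {c e : ℤ} {M : ℕ} [NeZero M] (he : e ≠ 0)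
    (h : IsCoprime (Int.gcd c M : ℤ) e) : ∃ k : ℤ, IsCoprime (c + k * M) e := by
  set g := Int.gcd c M with hg
  have hg0 : 0 < g := Int.gcd_pos_of_ne_zero_right _ (by exact_mod_cast NeZero.ne M)
  obtain ⟨c₁, hc⟩ : (g : ℤ) ∣ c := Int.gcd_dvd_left ..
  obtain ⟨M₁, hM⟩ : g ∣ M := by exact_mod_cast Int.gcd_dvd_right c M
  have hM0 : M₁ ≠ 0 := by
    rintro rfl
    exact NeZero.ne M (by rw [hM, mul_zero])
  -- `c / g` is a unit modulo `M / g`, and units modulo `M / g` lift to units modulo `(M / g) e`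
  have hcop : IsCoprime c₁ (M₁ : ℤ) := by
    rw [Int.isCoprime_iff_gcd_eq_one]
    have h1 : Int.gcd (g * c₁) (g * M₁ : ℤ) = g * Int.gcd c₁ M₁ := by
      rw [Int.gcd_mul_left]; simp
    rw [← hc, ← Nat.cast_mul, ← hM, ← hg] at h1
    exact Nat.eq_of_mul_eq_mul_left hg0 (by rw [mul_one]; exact h1.symm)
  have : NeZero (M₁ * e.natAbs) := ⟨mul_ne_zero hM0 (Int.natAbs_ne_zero.mpr he)⟩
  obtain ⟨u, hu⟩ := ZMod.unitsMap_surjective (Dvd.intro e.natAbs (rfl : M₁ * e.natAbs = _))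
    ((ZMod.unitOfIsCoprime c₁ hcop))
  have hu' : (((u : ZMod (M₁ * e.natAbs)).val : ℤ) : ZMod M₁) = c₁ := by
    have := congrArg Units.val hu
    rw [ZMod.unitsMap_val] at this
    simpa using this
  obtain ⟨k, hk⟩ := (ZMod.intCast_eq_intCast_iff_dvd_sub _ _ M₁).mp hu'
  refine ⟨-k, ?_⟩
  have h2 : c + -k * M = g * (u : ZMod (M₁ * e.natAbs)).val := by
    rw [hM, hc]; push_cast
    linear_combination (g : ℤ) * hk
  rw [h2]
  refine h.mul_left ?_
  have h3 := (ZMod.val_coe_unit_coprime u).coprime_mul_left_right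
  rw [Int.isCoprime_iff_gcd_eq_one, Int.gcd_eq_natAbs, Int.natAbs_natCast]
  exact h3

/-- Every matrix of determinant `1` modulo `M` lifts to `SL₂(ℤ)`. -/
lemma exists_lift_SL2 {M : ℕ} [NeZero M] {a b c e : ℤ} (h : a * e - b * c ≡ 1 [ZMOD M]) :
    ∃ γ : Matrix.SpecialLinearGroup (Fin 2) ℤ, (γ 0 0 : ZMod M) = a ∧ (γ 0 1 : ZMod M) = b ∧
      (γ 1 0 : ZMod M) = c ∧ (γ 1 1 : ZMod M) = e := by
  obtain ⟨e', he0, he⟩ : ∃ e' : ℤ, e' ≠ 0 ∧ (e' : ZMod M) = e := by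
    by_cases h0 : e = 0
    · exact ⟨M, by exact_mod_cast NeZero.ne M, by simp [h0]⟩
    · exact ⟨e, h0, rfl⟩
  have h' : a * e' - b * c ≡ 1 [ZMOD M] := by
    rw [← ZMod.intCast_eq_intCast_iff] at h ⊢
    push_cast at h ⊢
    rw [he, h]
  obtain ⟨w, hw⟩ := h'.symm.dvd
  have hcop : IsCoprime (Int.gcd c M : ℤ) e' := by
    obtain ⟨x, hx⟩ : (Int.gcd c M : ℤ) ∣ c := Int.gcd_dvd_left ..
    obtain ⟨y, hy⟩ : (Int.gcd c M : ℤ) ∣ M := Int.gcd_dvd_right ..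
    refine ⟨-(b * x + w * y), a, ?_⟩
    linear_combination hw + b * hx + w * hy
  obtain ⟨k, u, v, hk⟩ := exists_isCoprime_add_mul he0 hcop
  set c' := c + k * M
  have hw' : a * e' - b * c' - 1 = M * (w - b * k) := by
    simp only [c']; linear_combination hw
  refine ⟨⟨!![a - M * ((w - b * k) * v), b + M * ((w - b * k) * u); c', e'], ?_⟩, ?_, ?_, ?_, ?_⟩
  · rw [Matrix.det_fin_two_of]
    linear_combination hw' - M * (w - b * k) * hk
  · simp
  · simp
  · simp [c']
  · simpa using he

/-! ### Galois conjugation -/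

namespace HahnSeries

variable {K L F : Type*} [Field K] [Field L] [FunLike F K L] [RingHomClass F K L] (φ : F)
  (x y : LaurentSeries K)

lemma map_mul_of_ringHom : (x * y).map φ = (x.map φ * y.map φ : LaurentSeries L) :=
  HahnSeries.map_mul ((φ : K →+* L) : K →ₙ+* L)

lemma map_div_of_ringHom : (x / y).map φ = (x.map φ / y.map φ : LaurentSeries L) := by
  have hz : (0 : LaurentSeries K).map φ = (0 : LaurentSeries L) := by ext; simp
  rcases eq_or_ne y 0 with rfl | hy
  · rw [div_zero, hz, div_zero]
  have hy' : (y.map φ : LaurentSeries L) ≠ 0 := by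
    intro h0
    refine hy (HahnSeries.ext (funext fun k => (φ : K →+* L).injective ?_))
    have := congrArg (fun s => HahnSeries.coeff s k) h0
    simpa using this
  rw [eq_div_iff hy', ← map_mul_of_ringHom, div_mul_cancel₀ _ hy]

lemma map_pow_of_ringHom (n : ℕ) :
    (x ^ (n + 1)).map φ = (x.map φ ^ (n + 1) : LaurentSeries L) := by
  induction n with
  | zero => simp
  | succ n ih => rw [pow_succ x, pow_succ (x.map φ), ← ih, map_mul_of_ringHom]

end HahnSeries

section Parity

variable {N : ℕ} (ψ : DirichletCharacter ℂ N)

lemma even_inv_iff : ψ⁻¹.Even ↔ ψ.Even := by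
  rw [DirichletCharacter.Even, DirichletCharacter.Even, MulChar.inv_apply_eq_inv']
  exact inv_eq_one

lemma charEps_inv : charEps ψ⁻¹ = charEps ψ := by
  unfold charEps
  classical exact if_congr (even_inv_iff ψ) rfl rfl

lemma even_pow_iff {n : ℕ} (hn : Odd n) : (ψ ^ n).Even ↔ ψ.Even := by
  rw [DirichletCharacter.Even, DirichletCharacter.Even, MulChar.pow_apply' ψ hn.pos.ne']
  rcases ψ.even_or_odd with h | h
  · rw [DirichletCharacter.Even] at h; simp [h]
  · rw [DirichletCharacter.Odd] at h; simp [h, hn.neg_one_pow]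

lemma charEps_pow {n : ℕ} (hn : Odd n) : charEps (ψ ^ n) = charEps ψ := by
  unfold charEps
  classical exact if_congr (even_pow_iff ψ hn) rfl rfl

lemma charSign_pow {n : ℕ} (hn : Odd n) : charSign (ψ ^ n) = charSign ψ := by
  unfold charSign
  classical exact if_congr (even_pow_iff ψ hn) rfl rfl

lemma charSign_eq : charSign ψ = 1 - 2 * charEps ψ := by
  unfold charSign charEps; split_ifs <;> simp

end Parity

section Galois

variable {N m M : ℕ} [NeZero M]

lemma mem_cycField_of_pow_eq_one {z : ℂ} (hz : z ^ M = 1) : z ∈ cycField M := by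
  obtain ⟨i, -, rfl⟩ := (zetaM_isPrimitiveRoot M).eq_pow_of_pow_eq_one hz
  exact pow_mem (zetaM_mem M) i

lemma sigmaAut_of_pow_eq_one (d : (ZMod M)ˣ) {x : cycField M} (hx : x ^ M = 1) :
    sigmaAut M d x = x ^ (d : ZMod M).val := by
  have : NumberField (cycField M) := IsCyclotomicExtension.numberField {M} ℚ (cycField M)
  have h := IsCyclotomicExtension.Rat.galEquivZMod_apply_of_pow_eq M (cycField M)
    (sigmaAut M d) hx
  have h2 : IsCyclotomicExtension.Rat.galEquivZMod M (cycField M) (sigmaAut M d) = d :=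
    MulEquiv.apply_symm_apply _ _
  rw [h, h2]

lemma apply_pow_eq_one {ψ : DirichletCharacter ℂ N} (hψ : ψ ^ M = 1) {k : ZMod N}
    (hk : IsUnit k) : ψ k ^ M = 1 := by
  rw [← MulChar.pow_apply' ψ (NeZero.ne M), hψ, MulChar.one_apply hk]

lemma char_mem_cycField {ψ : DirichletCharacter ℂ N} (hψ : ψ ^ M = 1) (k : ZMod N) :
    ψ k ∈ cycField M := by
  by_cases hk : IsUnit k
  · exact mem_cycField_of_pow_eq_one (apply_pow_eq_one hψ hk)
  · rw [MulChar.map_nonunit _ hk]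
    exact zero_mem _

/-- The automorphism `σ_d` replaces `ψ` by `ψ ^ d`. -/
lemma sigmaAut_char {ψ : DirichletCharacter ℂ N} (hψ : ψ ^ M = 1) (hM : M ≠ 1) (d : (ZMod M)ˣ)
    (k : ZMod N) : (sigmaAut M d ⟨ψ k, char_mem_cycField hψ k⟩ : ℂ) =
      (ψ ^ (d : ZMod M).val) k := by
  have hd : (d : ZMod M).val ≠ 0 := by
    have : Fact (1 < M) := ⟨by have := NeZero.pos M; omega⟩
    exact (ZMod.val_ne_zero _).mpr d.ne_zero
  rw [MulChar.pow_apply' ψ hd]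
  by_cases hk : IsUnit k
  · rw [sigmaAut_of_pow_eq_one d (Subtype.ext (by simpa using apply_pow_eq_one hψ hk))]
    simp
  · have : (⟨ψ k, char_mem_cycField hψ k⟩ : cycField M) = 0 :=
      Subtype.ext (MulChar.map_nonunit _ hk)
    rw [this, map_zero, MulChar.map_nonunit _ hk, zero_pow hd]
    rfl

end Galois

lemma inv_pow_eq_one {N M : ℕ} {ψ : DirichletCharacter ℂ N} (hψ : ψ ^ M = 1) : ψ⁻¹ ^ M = 1 := by
  rw [inv_pow, hψ, inv_one]

lemma pow_pow_eq_one {N M : ℕ} {ψ : DirichletCharacter ℂ N} (hψ : ψ ^ M = 1) (d : ℕ) :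
    (ψ ^ d) ^ M = 1 := by
  rw [← pow_mul, mul_comm, pow_mul, hψ, one_pow]

lemma even_level (N m : ℕ) : Even (24 * m * N ^ 2) := ⟨12 * m * N ^ 2, by ring⟩

section Series

variable {N : ℕ} (m : ℕ) [NeZero N] [NeZero m]

instance level_neZero : NeZero (24 * m * N ^ 2) :=
  ⟨by exact_mod_cast level_ne_zero (N := N) (m := m)⟩

/-- The expansion of `θ_ψ(τ/N)` in powers of `q^{1/M}`, `M = 24 m N²`. -/
def thetaSeries {ψ : DirichletCharacter ℂ N} (hψ : ψ ^ (24 * m * N ^ 2) = 1) :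
    LaurentSeries (cycField (24 * m * N ^ 2)) :=
  sparseSeries (fun k : ℤ => (k : cycField (24 * m * N ^ 2)) ^ charEps ψ *
      ⟨ψ (k : ZMod N), char_mem_cycField hψ _⟩)
    (fun k => (12 * m : ℤ) * (1 * k + 0) ^ 2) (fun k => by positivity)
    (finite_preimage_mul_sq (by have := NeZero.pos m; positivity) one_pos)

/-- The expansion of `η(τ/N)` in powers of `q^{1/M}`, `M = 24 m N²`. -/
def etaSeries (N m : ℕ) [NeZero N] [NeZero m] : LaurentSeries (cycField (24 * m * N ^ 2)) :=
  sparseSeries (fun n : ℤ => (-1) ^ n) (fun n => (m * N : ℤ) * (6 * n + 1) ^ 2)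
    (fun n => by positivity)
    (finite_preimage_mul_sq (by have := NeZero.pos m; have := NeZero.pos N; positivity)
      (by norm_num))

/-- The expansion of `A_ψ` in powers of `q^{1/M}`, `M = 24 m N²`. -/
def funASeries {ψ : DirichletCharacter ℂ N} (hψ : ψ ^ (24 * m * N ^ 2) = 1) :
    LaurentSeries (cycField (24 * m * N ^ 2)) :=
  thetaSeries m hψ / etaSeries N m ^ (2 * charEps ψ + 1)

variable {m}

/-- The quotient of the two theta series, taken in the field of Laurent series over `ℚ(ζ_M)`. -/
theorem hasFourierExpansion_funA {ψ : DirichletCharacter ℂ N} (hψ : ψ ^ (24 * m * N ^ 2) = 1) :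
    HasFourierExpansion (24 * m * N ^ 2) (funA ψ) (toComplexSeries (funASeries m hψ)) := by
  have hmC : (m : ℂ) ≠ 0 := Nat.cast_ne_zero.mpr (NeZero.ne m)
  have hNC : (N : ℂ) ≠ 0 := Nat.cast_ne_zero.mpr (NeZero.ne N)
  have hθ : HasFourierExpansion (24 * m * N ^ 2) (fun τ : ℍ => thetaChar ψ (τ / N))
      (toComplexSeries (thetaSeries m hψ)) := by
    rw [toComplexSeries, thetaSeries, sparseSeries_map]
    refine hasFourierExpansion_sparseSeries _ _ _ _ fun τ => ?_
    rw [thetaChar_div_eq ψ τ.im_pos]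
    refine (hasSum_thetaChar ψ τ.im_pos).congr_fun fun k => ?_
    rw [map_mul, map_pow, map_intCast]
    change _ * ψ _ * _ = _
    congr 2
    push_cast
    field_simp
    ring
  have hη : HasFourierExpansion (24 * m * N ^ 2) (fun τ : ℍ => ModularForm.eta (τ / N))
      (toComplexSeries (etaSeries N m)) := by
    rw [toComplexSeries, etaSeries, sparseSeries_map]
    refine hasFourierExpansion_sparseSeries _ _ _ _ fun τ => ?_
    refine (hasSum_eta (div_natCast_im_pos τ.im_pos)).congr_fun fun k => ?_
    rw [map_zpow₀, map_neg, map_one]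
    congr 2
    push_cast
    field_simp
  have h := hθ.div (hη.pow (2 * charEps ψ)) fun τ =>
    pow_ne_zero _ (ModularForm.eta_ne_zero (div_natCast_im_pos τ.im_pos))
  rw [toComplexSeries, funASeries, HahnSeries.map_div_of_ringHom, HahnSeries.map_pow_of_ringHom]
  refine HasFourierExpansion.congr h fun τ => ?_
  rw [funA, add_comm 1]

/-- The coefficients of the eta series and the factors `k^ε` are rational, so `σ_d` acts on the
expansion of `A_ψ` through the values of `ψ` only. The parity of `ψ^d` is that of `ψ`, because `d`
is odd. -/
theorem funASeries_map_sigmaAut {ψ φ : DirichletCharacter ℂ N} (hψ : ψ ^ (24 * m * N ^ 2) = 1)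
    (hφ : φ ^ (24 * m * N ^ 2) = 1) (d : (ZMod (24 * m * N ^ 2))ˣ)
    (h : φ = ψ ^ (d : ZMod (24 * m * N ^ 2)).val) (hε : charEps φ = charEps ψ) :
    (funASeries m hψ).map (sigmaAut _ d) = funASeries m hφ := by
  have hm := NeZero.pos m
  have hN := NeZero.pos N
  have hM : 24 * m * N ^ 2 ≠ 1 := by
    intro h1
    have := Nat.eq_one_of_mul_eq_one_right h1
    omega
  have hθ : (thetaSeries m hψ).map (sigmaAut _ d) =
      thetaSeries m hφ := by
    rw [thetaSeries, thetaSeries, sparseSeries_map]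
    congr 1
    ext1 k
    rw [map_mul, map_pow, map_intCast, hε]
    congr 1
    exact Subtype.ext ((sigmaAut_char hψ hM d k).trans (congrFun (congrArg DFunLike.coe h.symm) _))
  have hη : (etaSeries N m).map (sigmaAut _ d) = etaSeries N m := by
    rw [etaSeries, sparseSeries_map]
    congr 1
    ext1 k
    rw [map_zpow₀, map_neg, map_one]
  have h1 := HahnSeries.map_div_of_ringHom (sigmaAut _ d)
    (thetaSeries m hψ) (etaSeries N m ^ (2 * charEps ψ + 1))
  rw [HahnSeries.map_pow_of_ringHom, hθ, hη] at h1
  rw [funASeries, funASeries, hε, ← h1]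

/-! ### Membership in the field of modular functions -/

lemma isModularFunction_funA (hN : Odd N) {ψ : DirichletCharacter ℂ N}
    (hψ : ψ ^ (24 * m * N ^ 2) = 1) : IsModularFunction (24 * m * N ^ 2) (funA ψ) where
  meromorphic := ((differentiableOn_funA ψ).analyticOnNhd
    (isOpen_lt continuous_const Complex.continuous_im)).meromorphicNFOn
  invariant _ hγ τ := funA_invariant hN ψ hγ τ
  cusps γ := (isMeroAtInfty_funA_smul hN ψ γ).exists_hasFourierExpansion
  rational := ⟨_, hasFourierExpansion_funA hψ⟩

lemma toComplexSeries_mul {M : ℕ} (c d : LaurentSeries (cycField M)) :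
    toComplexSeries (c * d) = toComplexSeries c * toComplexSeries d :=
  HahnSeries.map_mul_of_ringHom _ c d

lemma hasFourierExpansion_funB {ψ : DirichletCharacter ℂ N} (hψ : ψ ^ (24 * m * N ^ 2) = 1) :
    HasFourierExpansion (24 * m * N ^ 2) (funB ψ)
      (toComplexSeries (funASeries m hψ * funASeries m (inv_pow_eq_one hψ))) := by
  rw [toComplexSeries_mul]
  exact (hasFourierExpansion_funA hψ).mul (hasFourierExpansion_funA (inv_pow_eq_one hψ))

lemma isModularFunction_funB (hN : Odd N) {ψ : DirichletCharacter ℂ N}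
    (hψ : ψ ^ (24 * m * N ^ 2) = 1) : IsModularFunction (24 * m * N ^ 2) (funB ψ) where
  meromorphic := (((differentiableOn_funA ψ).mul (differentiableOn_funA ψ⁻¹)).analyticOnNhd
    (isOpen_lt continuous_const Complex.continuous_im)).meromorphicNFOn
  invariant _ hγ τ := by rw [funB, funB, funA_invariant hN ψ hγ, funA_invariant hN ψ⁻¹ hγ]
  cusps γ := ((isMeroAtInfty_funA_smul hN ψ γ).mul
    (isMeroAtInfty_funA_smul hN ψ⁻¹ γ)).exists_hasFourierExpansion
  rational := ⟨_, hasFourierExpansion_funB hψ⟩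

/-- A unit modulo the even number `M` has odd representatives. -/
lemma odd_val_of_even {M : ℕ} (hM : Even M) (d : (ZMod M)ˣ) : Odd (d : ZMod M).val := by
  have h := ZMod.val_coe_unit_coprime d
  rw [← Nat.not_even_iff_odd]
  intro h2
  exact absurd (Nat.dvd_gcd h2.two_dvd hM.two_dvd) (by rw [h]; norm_num)

/-- `A_ψ` is conjugate to `A_{ψ^d}` under `σ_d`. -/
theorem isGaloisConjugate_funA (hN : Odd N) {ψ : DirichletCharacter ℂ N}
    (hψ : ψ ^ (24 * m * N ^ 2) = 1) (d : (ZMod (24 * m * N ^ 2))ˣ) :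
    IsGaloisConjugate (24 * m * N ^ 2) d (funA ψ)
      (funA (ψ ^ (d : ZMod (24 * m * N ^ 2)).val)) := by
  refine ⟨isModularFunction_funA hN hψ, isModularFunction_funA hN (pow_pow_eq_one hψ _),
    funASeries m hψ, hasFourierExpansion_funA hψ, ?_⟩
  rw [funASeries_map_sigmaAut hψ (pow_pow_eq_one hψ _) d rfl
    (charEps_pow ψ (odd_val_of_even (even_level N m) d))]
  exact hasFourierExpansion_funA _

/-- `B_ψ` is conjugate to `B_{ψ^d}` under `σ_d`. -/
theorem isGaloisConjugate_funB (hN : Odd N) {ψ : DirichletCharacter ℂ N}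
    (hψ : ψ ^ (24 * m * N ^ 2) = 1) (d : (ZMod (24 * m * N ^ 2))ˣ) :
    IsGaloisConjugate (24 * m * N ^ 2) d (funB ψ)
      (funB (ψ ^ (d : ZMod (24 * m * N ^ 2)).val)) := by
  have hd := odd_val_of_even (even_level N m) d
  have hψ' := inv_pow_eq_one hψ
  refine ⟨isModularFunction_funB hN hψ, isModularFunction_funB hN (pow_pow_eq_one hψ _),
    _, hasFourierExpansion_funB hψ, ?_⟩
  have h2 := hasFourierExpansion_funB (pow_pow_eq_one hψ (d : ZMod (24 * m * N ^ 2)).val)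
  rw [← funASeries_map_sigmaAut hψ _ d rfl (charEps_pow ψ hd),
    ← funASeries_map_sigmaAut hψ' _ d (inv_pow _ _).symm
      (by rw [charEps_inv, charEps_pow ψ hd, charEps_inv])] at h2
  rwa [HahnSeries.map_mul_of_ringHom]

end Series

/-! ### The action of the Cartan group -/

/-- The multiplier of `A_ψ A_φ`, for two characters of the same parity, under a lift `γ` of the
`SL₂`-part of a Cartan matrix of determinant `d`. -/
theorem funA_mul_funA_cartan {N m : ℕ} [NeZero N] [NeZero m] (hN : Odd N)
    (ψ φ : DirichletCharacter ℂ N) (hε : charEps φ = charEps ψ)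
    (γ : Matrix.SpecialLinearGroup (Fin 2) ℤ) {d t : ℤ}
    (h00 : γ 0 0 ≡ t [ZMOD (24 * m * N ^ 2 : ℕ)])
    (h01 : γ 0 1 ≡ -(N ^ 2 * (d * γ 1 0)) [ZMOD (24 * m * N ^ 2 : ℕ)])
    (h11 : d * γ 1 1 ≡ t [ZMOD (24 * m * N ^ 2 : ℕ)]) (τ : ℍ) :
    ψ (γ 0 0 : ZMod N) * φ (γ 0 0 : ZMod N) * (funA ψ (γ • τ) * funA φ (γ • τ)) =
      (-1) ^ ((N - charSign ψ) / 2 * (t - 1)) * (funA ψ τ * funA φ τ) := by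
  obtain ⟨k, hk⟩ := hN
  have hkZ : (N : ℤ) = 2 * k + 1 := by exact_mod_cast hk
  have h12 : (12 : ℤ) ∣ (24 * m * N ^ 2 : ℕ) := ⟨2 * m * N ^ 2, by push_cast; ring⟩
  have ha : γ 0 0 ≡ d * γ 1 1 [ZMOD 12] := (h00.trans h11.symm).of_dvd h12
  obtain ⟨j, hj⟩ := h01.dvd
  obtain ⟨b₀, hb₀⟩ : ∃ b₀, b₀ = -(d * γ 1 0) - 24 * m * j := ⟨_, rfl⟩
  have hb : γ 0 1 = N ^ 2 * b₀ := by
    rw [hb₀]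
    push_cast at hj
    linear_combination -hj
  have hbmod : b₀ ≡ -(d * γ 1 0) [ZMOD 12] :=
    Int.modEq_of_dvd ⟨2 * m * j, by rw [hb₀]; ring⟩
  have hdet := det_eq γ
  -- the parity conditions; the determinant is odd
  have parity : Odd (γ 0 0 + γ 1 0) ∧ Odd (b₀ + γ 1 1) ∧ Even (b₀ * (1 - γ 1 0)) := by
    rw [← ZMod.intCast_eq_one_iff_odd, ← ZMod.intCast_eq_one_iff_odd,
      ← ZMod.intCast_eq_zero_iff_even]
    have ha2 := (ZMod.intCast_eq_intCast_iff _ _ 2).mpr (ha.of_dvd (by norm_num : (2 : ℤ) ∣ 12))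
    have hb2 := (ZMod.intCast_eq_intCast_iff _ _ 2).mpr (hbmod.of_dvd (by norm_num : (2 : ℤ) ∣ 12))
    have hd2 := congrArg (Int.cast : ℤ → ZMod 2) hdet
    rw [hb, hkZ] at hd2
    push_cast at ha2 hb2 hd2 ⊢
    rw [ha2, hb2] at hd2 ⊢
    generalize (γ 1 0 : ZMod 2) = c at *
    generalize (γ 1 1 : ZMod 2) = e at *
    generalize (d : ZMod 2) = d at *
    generalize (k : ZMod 2) = k at *
    clear ha2 hb2
    revert c e d k
    decide
  let γ' : Matrix.SpecialLinearGroup (Fin 2) ℤ :=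
    ⟨!![γ 0 0, N * b₀; N * γ 1 0, γ 1 1], by
      rw [Matrix.det_fin_two_of]; rw [hb] at hdet; linear_combination hdet⟩
  rw [funA_mul_funA_smul ⟨k, hk⟩ ψ φ hε γ γ' b₀ hb parity.1 parity.2.1 parity.2.2 rfl rfl rfl rfl]
  have he : (charEps ψ : ℤ) = 0 ∨ (charEps ψ : ℤ) = 1 := by
    have := charEps_le_one ψ
    omega
  rw [zetaM_zpow_congr (cartan_exponent hkZ he γ γ' ha hbmod (h00.symm.of_dvd h12) rfl hb rfl rfl
    rfl rfl rfl rfl)]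
  have hs : ((N : ℤ) - charSign ψ) / 2 = k + charEps ψ := by
    rw [charSign_eq, hkZ]; omega
  rw [hs, zpow_mul]
  congr 2
  rw [zetaM_twelve_zpow, ← Complex.exp_pi_mul_I]
  congr 1
  push_cast
  ring

/-- The `SL₂`-part of a Cartan matrix lifts to `SL₂(ℤ)`; in terms of the determinant `d`, the lift
is congruent to `(t, -N²s; s/d, t/d)`. -/
lemma exists_cartan_lift {N M : ℕ} [NeZero M]
    (μ : Matrix.GeneralLinearGroup (Fin 2) (ZMod M)) (t s : ℤ)
    (hμ : (μ : Matrix (Fin 2) (Fin 2) (ZMod M)) =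
      !![(t : ZMod M), -(N : ZMod M) ^ 2 * (s : ZMod M); (s : ZMod M), (t : ZMod M)]) :
    ∃ γ : Matrix.SpecialLinearGroup (Fin 2) ℤ,
      (μ : Matrix (Fin 2) (Fin 2) (ZMod M)) =
        !![1, 0; 0, (Matrix.GeneralLinearGroup.det μ : ZMod M)] *
          (γ : Matrix (Fin 2) (Fin 2) ℤ).map (Int.cast : ℤ → ZMod M) ∧
      γ 0 0 ≡ t [ZMOD M] ∧
      γ 0 1 ≡ -(N ^ 2 * ((Matrix.GeneralLinearGroup.det μ : ZMod M).val * γ 1 0)) [ZMOD M] ∧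
      (Matrix.GeneralLinearGroup.det μ : ZMod M).val * γ 1 1 ≡ t [ZMOD M] := by
  set D := Matrix.GeneralLinearGroup.det μ with hD
  have hdet : (D : ZMod M) = t * t + N ^ 2 * s * s := by
    rw [hD, Matrix.GeneralLinearGroup.val_det_apply, hμ, Matrix.det_fin_two_of]
    ring
  obtain ⟨δ, hδ⟩ := ZMod.intCast_surjective ((D⁻¹ : (ZMod M)ˣ) : ZMod M)
  have hDδ : (D : ZMod M) * δ = 1 := by rw [hδ, Units.mul_inv]
  obtain ⟨γ, h00, h01, h10, h11⟩ := exists_lift_SL2 (M := M) (a := t) (b := -N ^ 2 * s)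
    (c := δ * s) (e := δ * t) (by
      rw [← ZMod.intCast_eq_intCast_iff]
      push_cast
      linear_combination hDδ - (δ : ZMod M) * hdet)
  push_cast at h01 h10 h11
  refine ⟨γ, ?_, ?_, ?_, ?_⟩
  · rw [hμ]
    ext i j
    fin_cases i <;> fin_cases j
    · simp [Matrix.mul_apply, h00]
    · simp [Matrix.mul_apply, h01]
    · simp [Matrix.mul_apply, h10, ← mul_assoc, hDδ]
    · simp [Matrix.mul_apply, h11, ← mul_assoc, hDδ]
  · exact (ZMod.intCast_eq_intCast_iff _ _ M).mp h00
  · rw [← ZMod.intCast_eq_intCast_iff]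
    push_cast
    rw [ZMod.natCast_zmod_val, h01, h10]
    linear_combination (N : ZMod M) ^ 2 * s * hDδ
  · rw [← ZMod.intCast_eq_intCast_iff]
    push_cast
    rw [ZMod.natCast_zmod_val, h11]
    linear_combination (t : ZMod M) * hDδ

theorem mainTheorem5 (N m n M : ℕ) [NeZero M] (hN : Odd N)
    (χ : DirichletCharacter ℂ N) (hχ : χ.IsPrimitive) (hm : orderOf χ = m)
    (hn : n = if Even m then m else 2 * m) (hM : M = 24 * m * N ^ 2)
    (μ : Matrix.GeneralLinearGroup (Fin 2) (ZMod M)) (t s : ℤ)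
    (hμ : (μ : Matrix (Fin 2) (Fin 2) (ZMod M)) =
      !![(t : ZMod M), -(N : ZMod M) ^ 2 * (s : ZMod M); (s : ZMod M), (t : ZMod M)]) :
    IsModularAction M μ (funB χ)
      (fun τ => (-1 : ℂ) ^ ((N - charSign χ) / 2 * (t - 1)) * funB (charPowDet χ μ) τ) ∧
    ∃ g : ℍ → ℂ, IsModularAction M μ (funA χ) g ∧
      ∀ τ : ℍ, g τ ^ n =
        (-1 : ℂ) ^ ((N - charSign χ) * n / 4 * (t - 1)) * funA (charPowDet χ μ) τ ^ n := by
  subst hM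
  have hN0 : NeZero N := ⟨hN.pos.ne'⟩
  have hm0 : NeZero m := ⟨by rintro rfl; exact NeZero.ne (24 * 0 * N ^ 2) (by simp)⟩
  have hχm : χ ^ m = 1 := by rw [← hm]; exact pow_orderOf_eq_one χ
  have hχM : χ ^ (24 * m * N ^ 2) = 1 := by
    rw [show 24 * m * N ^ 2 = m * (24 * N ^ 2) by ring, pow_mul, hχm, one_pow]
  obtain ⟨γ, hγ, h00, h01, h11⟩ := exists_cartan_lift μ t s hμ
  set D := Matrix.GeneralLinearGroup.det μ with hD
  have hd := odd_val_of_even (even_level N m) D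
  have hψ : charPowDet χ μ = χ ^ (D : ZMod (24 * m * N ^ 2)).val := rfl
  set ψ := charPowDet χ μ
  have hsign : charSign ψ = charSign χ := by rw [hψ, charSign_pow χ hd]
  -- modulo `N` the matrix `γ` is lower triangular
  have hu : IsUnit ((γ 0 0 : ℤ) : ZMod N) := by
    obtain ⟨j, hj⟩ := h01.dvd
    refine IsUnit.of_mul_eq_one (γ 1 1 : ZMod N) ?_
    have h := congrArg (Int.cast : ℤ → ZMod N) (det_eq γ)
    have hj' := congrArg (Int.cast : ℤ → ZMod N) hj
    push_cast at h hj'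
    rw [ZMod.natCast_self] at hj'
    have h0 : ((γ 0 1 : ℤ) : ZMod N) = 0 := by linear_combination -hj'
    simpa [h0] using h
  refine ⟨⟨funB ψ, isGaloisConjugate_funB hN hχM D, γ, hγ, fun τ => ?_⟩,
    fun τ => funA ψ (γ • τ), ⟨funA ψ, isGaloisConjugate_funA hN hχM D, γ, hγ, fun τ => rfl⟩,
    fun τ => ?_⟩
  · have h := funA_mul_funA_cartan hN ψ ψ⁻¹ (charEps_inv ψ) γ h00 h01 h11 τ
    rw [← MulChar.mul_apply, mul_inv_cancel, MulChar.one_apply hu, one_mul, hsign] at h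
    exact h.symm
  · have h := funA_mul_funA_cartan hN ψ ψ rfl γ h00 h01 h11 τ
    -- `n` is even, so that `A_ψ ^ n` is a power of `A_ψ²`
    obtain ⟨j, hj⟩ : ∃ j, n = 2 * j := by
      rw [hn]
      split_ifs with he
      · exact he.exists_two_nsmul m
      · exact ⟨m, rfl⟩
    have hψn : ψ (γ 0 0 : ZMod N) ^ n = 1 := by
      have hmn : m ∣ n := by rw [hn]; split_ifs; exacts [dvd_rfl, dvd_mul_left m 2]
      have hn0 : n ≠ 0 := by
        have := NeZero.ne m
        rw [hn]; split_ifs <;> omega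
      have hχn : χ ^ n = 1 := orderOf_dvd_iff_pow_eq_one.mp (hm ▸ hmn)
      rw [← MulChar.pow_apply' ψ hn0, hψ, ← pow_mul, mul_comm, pow_mul, hχn, one_pow,
        MulChar.one_apply hu]
    obtain ⟨w, hw⟩ : ∃ w : ℤ, N - charSign χ = 2 * w := by
      obtain ⟨k, rfl⟩ := hN
      refine ⟨k + charEps χ, ?_⟩
      rw [charSign_eq]; push_cast; ring
    have e1 : ((N : ℤ) - charSign χ) / 2 = w := by omega
    have e2 : ((N : ℤ) - charSign χ) * n / 4 = w * j := by
      rw [hw, hj]; push_cast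
      rw [show 2 * w * (2 * j) = 4 * (w * j) by ring]
      exact Int.mul_ediv_cancel_left _ (by norm_num)
    rw [hsign, e1] at h
    rw [e2]
    rw [hj, pow_mul] at hψn ⊢
    have h2 := congrArg (· ^ j) h
    simp only [mul_pow] at h2
    rw [← mul_pow, ← sq, hψn, one_mul] at h2
    rw [sq, mul_pow, h2, ← zpow_natCast, ← zpow_mul, pow_mul, sq, mul_pow]
    congr 2
    ring

end
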